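/- Let $f(x,y)=\bigl(y,\tfrac{x}{2}-y^3+\tfrac34 y\bigr)$ be Bieberbach's map, an automorphism of $\mathbb{C}^2$ which restricts to a bijection of $\mathbb{R}^2$. Let $K^{\pm}\subset\mathbb{C}^2$ be the set of points $z$ for which the orbit $\{f^{\pm n}(z):n\ge 0\}$ is bounded, $K=K^+\cap K^-$, $J^{\pm}=\partial K^{\pm}$ (boundary in $\mathbb{C}^2$) and $J=J^+\cap J^-$; write $A_{\mathbb{R}}=A\cap\mathbb{R}^2$ for $A\subset\mathbb{C}^2$. Let $p_\pm=\pm(\tfrac12,\tfrac12)$, $p=(-\tfrac{\sqrt5}{2},\tfrac{\sqrt5}{2})$ and $p'=-p$; the points $p_+,p_-,0$ are fixed by $f$, and $\{p,p'\}$ is a cycle of period two. Let $\Omega_\pm$ be the intersection with $\mathbb{R}^2$ of the basin of attraction $\{z\in\mathbb{C}^2: f^n(z)\to p_\pm\}$. For a bijection $g$ of $\mathbb{R}^2$ and a nonempty $A\subset\mathbb{R}^2$ let $W^s_g(A)=\{q\in\mathbb{R}^2: d(g^n(q),A)\to0\}$ and $W^u_g(A)=W^s_{g^{-1}}(A)$,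 with $d$ the distance in $\mathbb{R}^2$ and $n\to\infty$; put $W^{s}(0)=W^{s}_f(\{0\})$, $W^{s}(p,p')=W^{s}_f(\{p,p'\})$, and likewise for $W^u$. Closures of subsets of $\mathbb{R}^2$ are taken in $\mathbb{R}^2$. Let $Q_3=\{(x,y)\in\mathbb{R}^2: x\le-\tfrac{\sqrt5}{2},\ y\ge\tfrac{\sqrt5}{2}\}$ and $Q_3'=-Q_3$. An *admissible parametrization at $p$* is an injective $C^1$ immersion $\Gamma:\mathbb{R}\to\mathbb{R}^2$ with image $W^u_{f^2}(\{p\})$ and $\Gamma(0)=p$ such that $\Gamma'(0)$ is an eigenvector of $Df^2(p)$ for a real eigenvalue of absolute value greater than $1$ and points into the interior of $Q_3$ (that is, $p+t\,\Gamma'(0)\in\operatorname{int}Q_3$ for all small $t>0$). An admissible parametrization at $p'$ is defined in the same way, with $p'$ and $Q_3'$ in place of $p$ and $Q_3$. **Theorem.** Admissible parametrizations at $p$ and at $p'$ exist. For any admissible parametrizations $\Gamma_p$ at $p$ and $\Gamma_{p'}$ at $p'$, put $W^u_-(p,p')=\Gamma_p((-\infty,0))\cup\Gamma_{p'}((-\infty,0))$.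 Then: 1. $K_{\mathbb{R}}=\overline{W^u(0)}\cup W^u_-(p,p')\cup\{p,p'\}$; 2. $K^+_{\mathbb{R}}=\Omega_+\cup\Omega_-\cup W^s(0)\cup W^s(p,p')$; 3. $K^-_{\mathbb{R}}=\overline{W^u(0)}\cup W^u(p,p')$; 4. $J^+_{\mathbb{R}}=W^s(0)\cup W^s(p,p')$; 5. $J^-_{\mathbb{R}}=K^-_{\mathbb{R}}$; 6. $J_{\mathbb{R}}=\{0,p,p'\}\cup\bigl(W^u_-(p,p')\cap W^s(0)\bigr)$. -/

import Mathlib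

open Set Filter Topology

namespace Bieberbach

noncomputable section

/-- Bieberbach's automorphism `(x, y) ↦ (y, x/2 - y³ + 3y/4)` of the plane over a field `𝕜`
(used for `𝕜 = ℝ` and `𝕜 = ℂ`), bundled with its inverse `(x, y) ↦ (2x³ - 3x/2 + 2y, x)`. -/
def bmap (𝕜 : Type*) [Field 𝕜] [CharZero 𝕜] : 𝕜 × 𝕜 ≃ 𝕜 × 𝕜 where
  toFun q := (q.2, q.1 / 2 - q.2 ^ 3 + 3 / 4 * q.2)
  invFun q := (2 * q.1 ^ 3 - 3 / 2 * q.1 + 2 * q.2, q.1)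
  left_inv q := by
    apply Prod.ext
    · simp only
      ring
    · rfl
  right_inv q := by
    apply Prod.ext
    · rfl
    · simp only
      ring

/-- The standard inclusion of `ℝ²` in `ℂ²`. -/
def incl (q : ℝ × ℝ) : ℂ × ℂ := ((q.1 : ℂ), (q.2 : ℂ))

/-! ### Filled Julia sets and Julia sets in `ℂ²`, and their real parts -/

/-- `K⁺`: the points of `ℂ²` with bounded forward orbit. -/
def KPlus : Set (ℂ × ℂ) :=
  {z | Bornology.IsBounded (range fun n : ℕ => (bmap ℂ)^[n] z)}

/-- `K⁻`: the points of `ℂ²` with bounded backward orbit. -/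
def KMinus : Set (ℂ × ℂ) :=
  {z | Bornology.IsBounded (range fun n : ℕ => (bmap ℂ).symm^[n] z)}

/-- `K = K⁺ ∩ K⁻`. -/
def K : Set (ℂ × ℂ) := KPlus ∩ KMinus

/-- `J⁺ = ∂K⁺`, the boundary being taken in `ℂ²`. -/
def JPlus : Set (ℂ × ℂ) := frontier KPlus

/-- `J⁻ = ∂K⁻`, the boundary being taken in `ℂ²`. -/
def JMinus : Set (ℂ × ℂ) := frontier KMinus

/-- `J = J⁺ ∩ J⁻`. -/
def J : Set (ℂ × ℂ) := JPlus ∩ JMinus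

/-- The real part `A ∩ ℝ²` of a subset `A` of `ℂ²`, as a subset of `ℝ²`. -/
def realPart (A : Set (ℂ × ℂ)) : Set (ℝ × ℝ) := incl ⁻¹' A

/-! ### The periodic points -/

/-- The attracting fixed point `p₊ = (1/2, 1/2)`. -/
def fixPlus : ℝ × ℝ := (1 / 2, 1 / 2)

/-- The attracting fixed point `p₋ = (-1/2, -1/2)`. -/
def fixMinus : ℝ × ℝ := (-1 / 2, -1 / 2)

/-- The point `p = (-√5/2, √5/2)` of the saddle cycle of period two. -/
def p : ℝ × ℝ := (-(√5) / 2, √5 / 2)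

/-- The point `p' = (√5/2, -√5/2)` of the saddle cycle of period two. -/
def p' : ℝ × ℝ := (√5 / 2, -(√5) / 2)

/-! ### Basins, stable and unstable sets -/

/-- The real part of the basin of attraction in `ℂ²` of the real fixed point `a`. -/
def basin (a : ℝ × ℝ) : Set (ℝ × ℝ) :=
  realPart {z | Tendsto (fun n : ℕ => (bmap ℂ)^[n] z) atTop (𝓝 (incl a))}

/-- The stable manifold `{q : d(gⁿ(q), A) → 0}` of a (nonempty) set `A` for a bijection `g`
of the real plane. -/
def stableSet (g : ℝ × ℝ ≃ ℝ × ℝ) (A : Set (ℝ × ℝ)) : Set (ℝ × ℝ) :=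
  {q | Tendsto (fun n : ℕ => Metric.infDist (g^[n] q) A) atTop (𝓝 0)}

/-- The unstable manifold `{q : d(g⁻ⁿ(q), A) → 0}` of a (nonempty) set `A` for a bijection `g`
of the real plane. -/
def unstableSet (g : ℝ × ℝ ≃ ℝ × ℝ) (A : Set (ℝ × ℝ)) : Set (ℝ × ℝ) :=
  stableSet g.symm A

/-- `W^s(A)`, with respect to Bieberbach's map on `ℝ²`. -/
def Ws (A : Set (ℝ × ℝ)) : Set (ℝ × ℝ) := stableSet (bmap ℝ) A

/-- `W^u(A)`, with respect to Bieberbach's map on `ℝ²`. -/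
def Wu (A : Set (ℝ × ℝ)) : Set (ℝ × ℝ) := unstableSet (bmap ℝ) A

/-! ### The negative half `W^u_-(p, p')` of the unstable manifold of the saddle cycle -/

/-- The second iterate `f²` of Bieberbach's map on `ℝ²`. -/
def bmapSq : ℝ × ℝ ≃ ℝ × ℝ := (bmap ℝ).trans (bmap ℝ)

/-- The closed quadrant `Q₃ = {x ≤ -√5/2, y ≥ √5/2}` with corner `p`. -/
def Q₃ : Set (ℝ × ℝ) := {q | q.1 ≤ -(√5) / 2 ∧ √5 / 2 ≤ q.2}

/-- The reflection `Q₃'` of `Q₃` at the origin, a closed quadrant with corner `p'`. -/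
def Q₃' : Set (ℝ × ℝ) := {q | -q ∈ Q₃}

/-- `Γ` is a parametrization (an injective `C¹` immersion of the real line) of the unstable
manifold of the point `a` with respect to `f²`, with `Γ 0 = a`, whose tangent vector at `a` is an
unstable eigenvector of `D f²(a)` pointing into the interior of `Q`. -/
structure IsUnstableParam (Γ : ℝ → ℝ × ℝ) (a : ℝ × ℝ) (Q : Set (ℝ × ℝ)) : Prop where
  contDiff : ContDiff ℝ 1 Γ
  injective : Function.Injective Γ
  immersion : ∀ t, deriv Γ t ≠ 0
  range_eq : range Γ = unstableSet bmapSq {a}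
  map_zero : Γ 0 = a
  eigenvector : ∃ μ : ℝ, 1 < |μ| ∧ fderiv ℝ bmapSq a (deriv Γ 0) = μ • deriv Γ 0
  points_into : ∀ᶠ t : ℝ in 𝓝[>] 0, a + t • deriv Γ 0 ∈ interior Q

/-- `W^u_-(p, p') = Γ(ℝ₋) ∪ Γ'(ℝ₋)`, for parametrizations `Γ` and `Γ'` of the unstable manifolds
of `p` and `p'` with respect to `f²`. -/
def WuMinus (Γ Γ' : ℝ → ℝ × ℝ) : Set (ℝ × ℝ) := Γ '' Iio 0 ∪ Γ' '' Iio 0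

end

end Bieberbach

namespace Bieberbach

noncomputable section

/-! ### The map and its symmetry -/

section Generic

variable {𝕜 : Type*} [RCLike 𝕜]

/-! The real dynamics is governed by sup-norm squares. Put c = √5/2. For 1/2 ≤ r ≤ c the cubic part
of f is at most r/2 on [-r, r], so f maps the square of radius r into itself. For 1/2 < r < c,
`norm_bmap_bmap_lt` shows that f² strictly shrinks the norm bound. At r = c, by
`norm_bmap_bmap_lt_corner`, only p and p' fail to move into the open square. On the square of radius
1/2 the polynomial `lyapunov` decreases along orbits.

Hence compact invariant sets are controlled. They lie in the square of radius c. They lie in {p, p'}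
if they avoid the open square, and in the square of radius 1/2 if they stay inside the open square;
in the latter case, if they also avoid p₊ and p₋, they reduce to at most the origin. Applied to
limit sets of bounded orbits this gives `bounded_forward_orbit` and `bounded_backward_orbit`, which
carry statements 2 and 3. For 3 one also needs p₊ and p₋ to be limits of points of W^u(0). This
follows from the connectedness of the nested images of the small square.

The Julia sets need complex analysis. An escape criterion makes K⁺ and K⁻ closed, with orbits
bounded uniformly for bounded initial values. Cauchy's estimate then bounds the derivatives of all
iterates at an interior point. Since f⁻¹ multiplies volume forms by a constant of modulus 2, K⁻ has
empty interior, which is 5. Points attracted to 0 or to the 2-cycle have an expanding direction, so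
they are not interior to K⁺, while the basins of p₊ and p₋ are; this is 4.

The unstable curve of p comes from solving Poincaré's functional equation near 0 by successive
approximation and extending the solution by f². A point of this curve lying in K⁺, other than p, is
mapped into the open square by f². So lying in K⁺ and not lying in K⁺ are both open conditions on
either half of the curve, and connectedness decides each half from its behaviour near p. This gives
1. For 6, homoclinic points of 0 are excluded by the Lyapunov function, homoclinic points of the
cycle and connections from 0 to the cycle by the squares. Only connections from the cycle to 0
remain. -/

theorem bmap_apply (q : 𝕜 × 𝕜) : bmap 𝕜 q = (q.2, q.1 / 2 - q.2 ^ 3 + 3 / 4 * q.2) := rfl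

theorem bmap_symm_apply (q : 𝕜 × 𝕜) :
    (bmap 𝕜).symm q = (2 * q.1 ^ 3 - 3 / 2 * q.1 + 2 * q.2, q.1) := rfl

theorem continuous_bmap : Continuous (bmap 𝕜) := by
  change Continuous fun q : 𝕜 × 𝕜 => (q.2, q.1 / 2 - q.2 ^ 3 + 3 / 4 * q.2)
  fun_prop

theorem continuous_bmap_symm : Continuous (bmap 𝕜).symm := by
  change Continuous fun q : 𝕜 × 𝕜 => (2 * q.1 ^ 3 - 3 / 2 * q.1 + 2 * q.2, q.1)
  fun_prop

theorem bmap_neg (q : 𝕜 × 𝕜) : bmap 𝕜 (-q) = -bmap 𝕜 q := by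
  ext
  · rfl
  · simp only [bmap_apply, Prod.fst_neg, Prod.snd_neg]; ring

theorem bmap_symm_neg (q : 𝕜 × 𝕜) : (bmap 𝕜).symm (-q) = -(bmap 𝕜).symm q := by
  rw [Equiv.symm_apply_eq, bmap_neg, Equiv.apply_symm_apply]

theorem bmap_iterate_neg (n : ℕ) (q : 𝕜 × 𝕜) : (bmap 𝕜)^[n] (-q) = -(bmap 𝕜)^[n] q := by
  induction n with
  | zero => rfl
  | succ n ih => rw [Function.iterate_succ_apply', ih, bmap_neg, Function.iterate_succ_apply']

theorem bmap_symm_iterate_neg (n : ℕ) (q : 𝕜 × 𝕜) :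
    (bmap 𝕜).symm^[n] (-q) = -(bmap 𝕜).symm^[n] q := by
  induction n with
  | zero => rfl
  | succ n ih =>
    rw [Function.iterate_succ_apply', ih, bmap_symm_neg, Function.iterate_succ_apply']

/-! ### The attracting fixed points -/

/-- The derivative of f at the fixed point has no y-term in its second coordinate, since 3/4 - 3/4 =
0. The linear part therefore contributes r/2 and the quadratic remainder at most r/6. The first
coordinate of f is only a shift, so the contraction of the norm takes two iterates. The argument is
the same over ℝ and ℂ, and both cases are used. -/
theorem norm_bmap_sub_half_le {q : 𝕜 × 𝕜} {r : ℝ} (hr : r ≤ 1 / 10)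
    (hq : ‖q - (1 / 2, 1 / 2)‖ ≤ r) :
    ‖(bmap 𝕜 q).2 - 1 / 2‖ ≤ 2 / 3 * r := by
  obtain ⟨x, y⟩ := q
  rw [Prod.mk_sub_mk, Prod.norm_mk, max_le_iff] at hq
  have h : (bmap 𝕜 (x, y)).2 - 1 / 2
      = (x - 1 / 2) / 2 - (y - 1 / 2) * ((y - 1 / 2) * (3 / 2 + (y - 1 / 2))) := by
    simp only [bmap_apply]; ring
  have h0 : 0 ≤ r := (norm_nonneg _).trans hq.1
  have h1 : ‖(y - 1 / 2) * (3 / 2 + (y - 1 / 2))‖ ≤ 1 / 6 := by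
    rw [norm_mul]
    have : ‖(3 / 2 : 𝕜) + (y - 1 / 2)‖ ≤ 3 / 2 + 1 / 10 := by
      refine (norm_add_le _ _).trans (add_le_add ?_ (hq.2.trans hr))
      rw [norm_div]; simp
    calc _ ≤ (1 / 10 : ℝ) * (3 / 2 + 1 / 10) :=
          mul_le_mul (hq.2.trans hr) this (norm_nonneg _) (by norm_num)
      _ ≤ 1 / 6 := by norm_num
  rw [h]
  refine (norm_sub_le _ _).trans ?_
  rw [norm_div, norm_mul]
  have h2 : ‖(2 : 𝕜)‖ = 2 := by simp
  have h3 := mul_le_mul hq.2 h1 (norm_nonneg _) h0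
  rw [h2]
  linarith [hq.1]

theorem norm_bmap_sub_le {q : 𝕜 × 𝕜} {r : ℝ} (hr : r ≤ 1 / 10)
    (hq : ‖q - (1 / 2, 1 / 2)‖ ≤ r) :
    ‖bmap 𝕜 q - (1 / 2, 1 / 2)‖ ≤ r := by
  have h0 : 0 ≤ r := (norm_nonneg _).trans hq
  have h1 := norm_bmap_sub_half_le hr hq
  have h2 : ‖q.2 - 1 / 2‖ ≤ r := (norm_snd_le (q - (1 / 2, 1 / 2))).trans hq
  rw [Prod.norm_def]
  exact max_le h2 (h1.trans (by linarith))

theorem norm_bmap_bmap_sub_le {q : 𝕜 × 𝕜} {r : ℝ} (hr : r ≤ 1 / 10)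
    (hq : ‖q - (1 / 2, 1 / 2)‖ ≤ r) :
    ‖bmap 𝕜 (bmap 𝕜 q) - (1 / 2, 1 / 2)‖ ≤ 2 / 3 * r := by
  have h1 := norm_bmap_sub_half_le hr hq
  have h2 := norm_bmap_sub_half_le hr (norm_bmap_sub_le hr hq)
  rw [Prod.norm_def]
  exact max_le h1 h2

theorem norm_bmap_iterate_sub_le {q : 𝕜 × 𝕜} {r : ℝ} (hr : r ≤ 1 / 10)
    (hq : ‖q - (1 / 2, 1 / 2)‖ ≤ r) (n : ℕ) :
    ‖(bmap 𝕜)^[n] q - (1 / 2, 1 / 2)‖ ≤ r := by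
  induction n with
  | zero => exact hq
  | succ n ih => rw [Function.iterate_succ_apply']; exact norm_bmap_sub_le hr ih

theorem norm_bmap_iterate_two_mul_sub_le {q : 𝕜 × 𝕜}
    (hq : ‖q - (1 / 2, 1 / 2)‖ ≤ 1 / 10) (k : ℕ) :
    ‖(bmap 𝕜)^[2 * k] q - (1 / 2, 1 / 2)‖ ≤ (2 / 3) ^ k * (1 / 10) := by
  induction k with
  | zero => simpa using hq
  | succ k ih =>
    have h : ((2 : ℝ) / 3) ^ k * (1 / 10) ≤ 1 / 10 := by
      have : ((2 : ℝ) / 3) ^ k ≤ 1 := pow_le_one₀ (by norm_num) (by norm_num)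
      linarith
    have := norm_bmap_bmap_sub_le h ih
    rw [show 2 * (k + 1) = (2 * k + 1) + 1 by ring, Function.iterate_succ_apply',
      Function.iterate_succ_apply', pow_succ]
    linarith

theorem tendsto_bmap_iterate_of_norm_le {q : 𝕜 × 𝕜} (hq : ‖q - (1 / 2, 1 / 2)‖ ≤ 1 / 10) :
    Tendsto (fun n : ℕ => (bmap 𝕜)^[n] q) atTop (𝓝 (1 / 2, 1 / 2)) := by
  rw [Metric.tendsto_atTop]
  intro ε hε
  obtain ⟨k, hk⟩ := exists_pow_lt_of_lt_one hε (by norm_num : (2 / 3 : ℝ) < 1)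
  have h1 : ((2 : ℝ) / 3) ^ k ≤ 1 := pow_le_one₀ (by norm_num) (by norm_num)
  have h0 : 0 ≤ ((2 : ℝ) / 3) ^ k := by positivity
  refine ⟨2 * k, fun n hn => ?_⟩
  obtain ⟨m, rfl⟩ := Nat.exists_eq_add_of_le' hn
  rw [Function.iterate_add_apply, dist_eq_norm]
  refine (norm_bmap_iterate_sub_le (by linarith) (norm_bmap_iterate_two_mul_sub_le hq k) m).trans_lt
    (by linarith)

end Generic

/-! ### The invariant square -/

/-- Half of `√5`, the sup norm of the points of the saddle cycle. -/
def corner : ℝ := √5 / 2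

theorem corner_sq : corner ^ 2 = 5 / 4 := by
  rw [corner, div_pow, Real.sq_sqrt (by norm_num)]; norm_num

theorem one_lt_corner : 1 < corner := by
  have h0 : 0 ≤ corner := by unfold corner; positivity
  nlinarith [corner_sq]

theorem corner_lt : corner < 9 / 8 := by
  nlinarith [corner_sq, one_lt_corner]

theorem p_eq : p = (-corner, corner) := by simp [p, corner, neg_div]

theorem p'_eq : p' = (corner, -corner) := by simp [p', corner, neg_div]

theorem neg_p : -p = p' := by simp [p_eq, p'_eq]

theorem neg_p' : -p' = p := by simp [p_eq, p'_eq]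

theorem bmap_p : bmap ℝ p = p' := by
  rw [p_eq, p'_eq, bmap_apply]
  ext
  · rfl
  · simp only; linear_combination (-corner) * corner_sq

theorem bmap_p' : bmap ℝ p' = p := by
  rw [← neg_p, bmap_neg, bmap_p, neg_p']

theorem bmap_symm_p : (bmap ℝ).symm p = p' := by
  rw [Equiv.symm_apply_eq, bmap_p']

theorem bmap_symm_p' : (bmap ℝ).symm p' = p := by
  rw [Equiv.symm_apply_eq, bmap_p]

theorem norm_p : ‖p‖ = corner := by
  have := one_lt_corner
  rw [p_eq, Prod.norm_mk, norm_neg, max_self, Real.norm_of_nonneg (by linarith)]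

theorem norm_p' : ‖p'‖ = corner := by rw [← neg_p, norm_neg, norm_p]

/-- The critical values of the cubic are ±1/4, taken at ±1/2, and 1/4 ≤ r/2. At the ends |y| = r the
modulus is r |3/4 - r²|, which is at most r/2 exactly when 1/4 ≤ r² ≤ 5/4. This is where the two
extreme radii 1/2 and `corner` come from. -/
theorem abs_cubic_le {r y : ℝ} (hr : 1 / 2 ≤ r) (hrc : r ≤ corner) (hy : |y| ≤ r) :
    |-y ^ 3 + 3 / 4 * y| ≤ r / 2 := by
  have hc := corner_sq
  have hr2 : r ^ 2 ≤ 5 / 4 := by nlinarith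
  obtain ⟨h1, h2⟩ := abs_le.1 hy
  have hy2 : y ^ 2 ≤ r ^ 2 := by nlinarith
  rw [abs_le]
  constructor
  · nlinarith [mul_nonneg (by linarith : (0:ℝ) ≤ r - y) (sq_nonneg (2 * y + r)),
      mul_nonneg (by linarith : (0:ℝ) ≤ r + y) (sq_nonneg (2 * y - r)),
      mul_nonneg (by linarith : (0:ℝ) ≤ 1 + y + r - 1/2) (sq_nonneg (2 * y + 1)), sq_nonneg (2*y+1),
      mul_nonneg (by linarith : (0:ℝ) ≤ r - y) (by linarith : (0:ℝ) ≤ 5/4 - r^2)]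
  · nlinarith [mul_nonneg (by linarith : (0:ℝ) ≤ r + y) (sq_nonneg (2 * y - r)),
      mul_nonneg (by linarith : (0:ℝ) ≤ r + y) (sq_nonneg (2 * y - 1)), sq_nonneg (2*y-1),
      mul_nonneg (by linarith : (0:ℝ) ≤ r + y) (by linarith : (0:ℝ) ≤ 5/4 - r^2)]

theorem abs_cubic_lt_of_abs_lt {r y : ℝ} (hr : 1 / 2 < r) (hrc : r ≤ corner) (hy : |y| < r) :
    |-y ^ 3 + 3 / 4 * y| < r / 2 := by
  -- The weak bound at the smaller radius max |y| (1/2) gives the strict one at r.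
  have h := abs_cubic_le (le_max_right |y| (1 / 2)) ((max_lt hy hr).le.trans hrc)
    (le_max_left _ _)
  linarith [max_lt hy hr]

theorem abs_cubic_lt {r y : ℝ} (hr : 1 / 2 < r) (hrc : r < corner) (hy : |y| ≤ r) :
    |-y ^ 3 + 3 / 4 * y| < r / 2 := by
  rcases hy.lt_or_eq with h | h
  · exact abs_cubic_lt_of_abs_lt hr hrc.le h
  · have hc := corner_sq
    have hr2 : r ^ 2 < 5 / 4 := by nlinarith
    have hy2 : y ^ 2 = r ^ 2 := by rw [← h, sq_abs]
    have : -y ^ 3 + 3 / 4 * y = y * (3 / 4 - r ^ 2) := by rw [← hy2]; ring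
    rw [this, abs_mul, h]
    have : |3 / 4 - r ^ 2| < 1 / 2 := by
      rw [abs_lt]; constructor <;> nlinarith
    nlinarith

theorem norm_bmap_le {r : ℝ} (hr : 1 / 2 ≤ r) (hrc : r ≤ corner) {q : ℝ × ℝ} (hq : ‖q‖ ≤ r) :
    ‖bmap ℝ q‖ ≤ r := by
  obtain ⟨x, y⟩ := q
  rw [Prod.norm_mk, max_le_iff, Real.norm_eq_abs, Real.norm_eq_abs] at hq
  rw [bmap_apply, Prod.norm_mk, max_le_iff, Real.norm_eq_abs, Real.norm_eq_abs]
  refine ⟨hq.2, ?_⟩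
  have h := abs_cubic_le hr hrc hq.2
  simp only
  rw [abs_le] at *
  constructor <;> linarith [hq.1.1, hq.1.2]

theorem norm_bmap_iterate_le {r : ℝ} (hr : 1 / 2 ≤ r) (hrc : r ≤ corner) {q : ℝ × ℝ}
    (hq : ‖q‖ ≤ r) (n : ℕ) : ‖(bmap ℝ)^[n] q‖ ≤ r := by
  induction n with
  | zero => exact hq
  | succ n ih => rw [Function.iterate_succ_apply']; exact norm_bmap_le hr hrc ih

theorem norm_bmap_bmap_lt {r : ℝ} (hr : 1 / 2 < r) (hrc : r < corner) {q : ℝ × ℝ}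
    (hq : ‖q‖ ≤ r) : ‖bmap ℝ (bmap ℝ q)‖ < r := by
  have key : ∀ q : ℝ × ℝ, ‖q‖ ≤ r → ‖(bmap ℝ q).2‖ < r := by
    rintro ⟨x, y⟩ hq
    rw [Prod.norm_mk, max_le_iff, Real.norm_eq_abs, Real.norm_eq_abs] at hq
    have h := abs_cubic_lt hr hrc hq.2
    rw [bmap_apply, Real.norm_eq_abs]
    simp only
    rw [abs_le] at hq
    rw [abs_lt] at *
    constructor <;> linarith [hq.1.1, hq.1.2]
  rw [Prod.norm_def]
  exact max_lt (key q hq) (key _ (norm_bmap_le hr.le hrc.le hq))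

/-- The extreme value is reached only if |y| = `corner` and x/2 has the sign of the cubic term with
|x| = `corner`, which singles out p and p'. Two iterates are needed because one of them improves
only the second coordinate. -/
theorem norm_bmap_bmap_lt_corner {q : ℝ × ℝ} (hq : ‖q‖ ≤ corner) (hp : q ≠ p) (hp' : q ≠ p') :
    ‖bmap ℝ (bmap ℝ q)‖ < corner := by
  have h1 := one_lt_corner
  have hc := corner_sq
  have key : ∀ q : ℝ × ℝ, ‖q‖ ≤ corner → q ≠ p → q ≠ p' → ‖(bmap ℝ q).2‖ < corner := by
    rintro ⟨x, y⟩ hq hp hp'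
    rw [Prod.norm_mk, max_le_iff, Real.norm_eq_abs, Real.norm_eq_abs] at hq
    rw [bmap_apply, Real.norm_eq_abs]
    simp only
    rcases hq.2.lt_or_eq with h | h
    · have h' := abs_cubic_lt_of_abs_lt (by linarith) le_rfl h
      rw [abs_le] at hq
      rw [abs_lt] at *
      constructor <;> linarith [hq.1.1, hq.1.2]
    · obtain ⟨hx1, hx2⟩ := abs_le.1 hq.1
      rcases (abs_eq (by linarith)).1 h with rfl | rfl
      · have hx : -corner < x := hx1.lt_of_ne fun h => hp (by rw [p_eq, h])
        have : -corner ^ 3 + 3 / 4 * corner = -corner / 2 := by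
          linear_combination (-corner) * hc
        rw [abs_lt]; constructor <;> linarith
      · have hx : x < corner := hx2.lt_of_ne fun h => hp' (by rw [p'_eq, h])
        have : -(-corner) ^ 3 + 3 / 4 * -corner = corner / 2 := by
          linear_combination corner * hc
        rw [abs_lt]; constructor <;> linarith
  have h2 : bmap ℝ q ≠ p := fun h => hp' (by rw [← bmap_symm_p, ← h, Equiv.symm_apply_apply])
  have h3 : bmap ℝ q ≠ p' := fun h => hp (by rw [← bmap_symm_p', ← h, Equiv.symm_apply_apply])
  rw [Prod.norm_def]
  exact max_lt (key q hq hp hp') (key _ (norm_bmap_le (by linarith) le_rfl hq) h2 h3)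

/-! ### Compact invariant sets -/

/-- Here a, b are consecutive terms of an orbit whose terms are bounded by L = |b|. Suppose b >
`corner`. The bound on the term preceding a forces a < -`corner`, and then the term following b
falls below -b. Both estimates are equalities on the 2-cycle. -/
theorem abs_le_corner_of_three {L a b : ℝ} (hb : |b| = L) (ha : |a| ≤ L)
    (h1 : |a / 2 - b ^ 3 + 3 / 4 * b| ≤ L) (h2 : |2 * a ^ 3 - 3 / 2 * a + 2 * b| ≤ L) :
    L ≤ corner := by
  have hc := corner_sq
  have hc1 := one_lt_corner
  by_contra! hL
  wlog hpos : 0 ≤ b generalizing a b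
  · refine this (a := -a) (b := -b) (by rwa [abs_neg]) (by rwa [abs_neg]) ?_ ?_ (by linarith)
    · rw [← abs_neg]; convert h1 using 2; ring
    · rw [← abs_neg]; convert h2 using 2; ring
  rw [abs_of_nonneg hpos] at hb
  subst hb
  have h3 : a < -corner := by
    by_contra! h
    nlinarith [(abs_le.1 h2).2, mul_nonneg (by linarith : 0 ≤ a + corner)
      (by nlinarith [sq_nonneg (2 * a - corner)] : 0 ≤ a ^ 2 - a * corner + 1 / 2)]
  have h4 := (abs_le.1 h1).1
  nlinarith [mul_pos (by linarith : 0 < b - corner)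
    (by nlinarith : 0 < b ^ 2 + b * corner + corner ^ 2 - 7 / 4)]

section Invariant

variable {M : Set (ℝ × ℝ)}

theorem bmap_mem_of_image_eq (hM : bmap ℝ '' M = M) {q : ℝ × ℝ} (hq : q ∈ M) : bmap ℝ q ∈ M := by
  rw [← hM]; exact mem_image_of_mem _ hq

theorem bmap_symm_mem_of_image_eq (hM : bmap ℝ '' M = M) {q : ℝ × ℝ} (hq : q ∈ M) :
    (bmap ℝ).symm q ∈ M := by
  rw [← hM] at hq
  obtain ⟨r, hr, rfl⟩ := hq
  rwa [Equiv.symm_apply_apply]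

theorem norm_le_corner_of_isCompact (hc : IsCompact M) (hM : bmap ℝ '' M = M) {q : ℝ × ℝ}
    (hq : q ∈ M) : ‖q‖ ≤ corner := by
  obtain ⟨a, ha, hmax⟩ := hc.exists_isMaxOn ⟨q, hq⟩ continuous_norm.continuousOn
  refine (hmax hq).trans ?_
  -- The first coordinate of a point is the second coordinate of its preimage, so the maximum may be
  -- assumed to occur in the second coordinate.
  obtain ⟨b, hb, hbn⟩ : ∃ b ∈ M, |b.2| = ‖a‖ := by
    rcases max_choice ‖a.1‖ ‖a.2‖ with h | h
    · exact ⟨(bmap ℝ).symm a, bmap_symm_mem_of_image_eq hM ha, by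
        rw [Prod.norm_def, h]; rfl⟩
    · exact ⟨a, ha, by rw [Prod.norm_def, h]; rfl⟩
  have h1 : |b.1| ≤ ‖a‖ := (norm_fst_le b).trans (hmax hb)
  have h2 := (norm_snd_le _).trans (hmax (bmap_mem_of_image_eq hM hb))
  have h3 := (norm_fst_le _).trans (hmax (bmap_symm_mem_of_image_eq hM hb))
  exact abs_le_corner_of_three hbn h1 h2 h3

theorem subset_pair_of_isCompact (hc : IsCompact M) (hM : bmap ℝ '' M = M)
    (h : ∀ q ∈ M, corner ≤ ‖q‖) : M ⊆ {p, p'} := by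
  intro q hq
  by_contra hqp
  simp only [mem_insert_iff, mem_singleton_iff, not_or] at hqp
  have h1 := norm_bmap_bmap_lt_corner (norm_le_corner_of_isCompact hc hM hq) hqp.1 hqp.2
  exact (h _ (bmap_mem_of_image_eq hM (bmap_mem_of_image_eq hM hq))).not_gt h1

theorem norm_le_half_of_isCompact (hc : IsCompact M) (hM : bmap ℝ '' M = M)
    (h : ∀ q ∈ M, ‖q‖ < corner) {q : ℝ × ℝ} (hq : q ∈ M) : ‖q‖ ≤ 1 / 2 := by
  obtain ⟨a, ha, hmax⟩ := hc.exists_isMaxOn ⟨q, hq⟩ continuous_norm.continuousOn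
  refine (hmax hq).trans ?_
  by_contra! hlt
  -- The maximal point is the f²-image of a point of no larger norm, contradicting strict shrinking.
  have ha' := bmap_symm_mem_of_image_eq hM (bmap_symm_mem_of_image_eq hM ha)
  have := norm_bmap_bmap_lt hlt (h a ha) (hmax ha')
  simp only [Equiv.apply_symm_apply, lt_self_iff_false] at this

/-! ### A Lyapunov function on the square of side one -/

/-- A Lyapunov function for `bmap ℝ` on the square `[-1/2, 1/2]²`. -/
def lyapunov (q : ℝ × ℝ) : ℝ :=
  q.1 ^ 2 / 2 - q.1 ^ 4 + (q.2 ^ 2 / 2 - q.2 ^ 4)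
    - 3 / 2 * (q.1 - 4 / 3 * q.1 ^ 3) * (q.2 - 4 / 3 * q.2 ^ 3)

theorem continuous_lyapunov : Continuous lyapunov := by
  unfold lyapunov; fun_prop

/-- Write V(t) = t²/2 - t⁴ and W(t) = t - 4t³/3, so that the function is V(x) + V(y) - (3/2) W(x)
W(y). For z the next term of the orbit, (3/2) W(y) = 2z - x, so the change V(z) - V(x) - (2z -
x)(W(z) - W(x)) involves only x and z. Because V' = t W', it is divisible by (z - x)²; the cofactor
has a sign on the square. -/
theorem lyapunov_bmap_le {q : ℝ × ℝ} (hq : ‖q‖ ≤ 1 / 2) :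
    lyapunov (bmap ℝ q) ≤ lyapunov q - 1 / 4 * ((bmap ℝ q).2 - q.1) ^ 4 := by
  have hz := (norm_snd_le _).trans (norm_bmap_le le_rfl (by linarith [one_lt_corner]) hq)
  have hx := (norm_fst_le _).trans hq
  obtain ⟨x, y⟩ := q
  have key : lyapunov (bmap ℝ (x, y)) = lyapunov (x, y) - ((bmap ℝ (x, y)).2 - x) ^ 2 *
      (((bmap ℝ (x, y)).2 - x) ^ 2 + 10 / 3 * (1 / 4 - x ^ 2)
        + 8 / 3 * (1 / 4 - (bmap ℝ (x, y)).2 ^ 2)) := by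
    simp only [lyapunov, bmap_apply]; ring
  have hsq : ∀ t : ℝ, ‖t‖ ≤ 1 / 2 → 0 ≤ 1 / 4 - t ^ 2 := fun t ht => by
    rw [Real.norm_eq_abs, abs_le] at ht
    nlinarith [ht.1, ht.2]
  rw [key]
  have h1 := mul_nonneg (sq_nonneg ((bmap ℝ (x, y)).2 - x)) (hsq _ hx)
  have h2 := mul_nonneg (sq_nonneg ((bmap ℝ (x, y)).2 - x)) (hsq _ hz)
  simp only at h1 ⊢
  linarith [pow_nonneg (sq_nonneg ((bmap ℝ (x, y)).2 - x)) 2]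

theorem lyapunov_bmap_le_self {q : ℝ × ℝ} (hq : ‖q‖ ≤ 1 / 2) :
    lyapunov (bmap ℝ q) ≤ lyapunov q := by
  have h : 0 ≤ ((bmap ℝ q).2 - q.1) ^ 4 := Even.pow_nonneg (by decide) _
  linarith only [lyapunov_bmap_le hq, h]

/-- A point of the square at which the Lyapunov function is twice stationary is fixed. -/
theorem eq_fixed_of_lyapunov_eq {q : ℝ × ℝ} (hq : ‖q‖ ≤ 1 / 2)
    (h : lyapunov q ≤ lyapunov (bmap ℝ (bmap ℝ q))) :
    q = 0 ∨ q = fixPlus ∨ q = fixMinus := by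
  have hq' := norm_bmap_le le_rfl (by linarith [one_lt_corner]) hq
  have h1 := lyapunov_bmap_le hq
  have h2 := lyapunov_bmap_le hq'
  have h5 : 0 ≤ ((bmap ℝ q).2 - q.1) ^ 4 := Even.pow_nonneg (by decide) _
  have h6 : 0 ≤ ((bmap ℝ (bmap ℝ q)).2 - (bmap ℝ q).1) ^ 4 := Even.pow_nonneg (by decide) _
  have h3 : ((bmap ℝ q).2 - q.1) ^ 4 = 0 := le_antisymm (by linarith only [h, h1, h2, h6]) h5
  have h4 : ((bmap ℝ (bmap ℝ q)).2 - (bmap ℝ q).1) ^ 4 = 0 :=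
    le_antisymm (by linarith only [h, h1, h2, h5]) h6
  have hx := (norm_fst_le _).trans hq
  have hy := (norm_snd_le _).trans hq
  obtain ⟨x, y⟩ := q
  have e1 := sub_eq_zero.1 (pow_eq_zero_iff (by norm_num) |>.1 h3)
  have e2 := sub_eq_zero.1 (pow_eq_zero_iff (by norm_num) |>.1 h4)
  rw [Real.norm_eq_abs, abs_le] at hx hy
  simp only [bmap_apply] at e1 e2
  rw [e1] at e2
  -- The point has period two. Subtracting the two equations leaves a factor 5/4 - (x² + xy + y²),
  -- which is positive because |x|, |y| ≤ 1/2.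
  have hxy : x = y := by
    have : (x - y) * (5 / 4 - (x ^ 2 + x * y + y ^ 2)) = 0 := by linear_combination e2 - e1
    rcases mul_eq_zero.1 this with h | h
    · linarith
    · have hx2 : x ^ 2 ≤ 1 / 4 := by nlinarith only [hx.1, hx.2]
      have hy2 : y ^ 2 ≤ 1 / 4 := by nlinarith only [hy.1, hy.2]
      linarith only [h, hx2, hy2, sq_nonneg (x - y)]
  subst hxy
  have : x * ((x - 1 / 2) * (x + 1 / 2)) = 0 := by linear_combination -e1
  rcases mul_eq_zero.1 this with h | h
  · left; rw [h]; rfl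
  rcases mul_eq_zero.1 h with h | h
  · right; left; rw [sub_eq_zero.1 h]; rfl
  · right; right; rw [eq_neg_of_add_eq_zero_left h, fixMinus]; norm_num

/-- A minimum point of the Lyapunov function is stationary under f², and so is the second preimage
of a maximum point. Both must be 0, so the function is constant on M and every point of M is
stationary. -/
theorem subset_zero_of_isCompact (hc : IsCompact M) (hM : bmap ℝ '' M = M)
    (h : ∀ q ∈ M, ‖q‖ ≤ 1 / 2) (hp : fixPlus ∉ M) (hm : fixMinus ∉ M) : M ⊆ {0} := by
  intro q hq
  have h0 : bmap ℝ 0 = 0 := by rw [bmap_apply]; simp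
  obtain ⟨a, ha, hmax⟩ := hc.exists_isMaxOn ⟨q, hq⟩ continuous_lyapunov.continuousOn
  obtain ⟨b, hb, hmin⟩ := hc.exists_isMinOn ⟨q, hq⟩ continuous_lyapunov.continuousOn
  have key : ∀ r ∈ M, lyapunov r ≤ lyapunov (bmap ℝ (bmap ℝ r)) → r = 0 := by
    intro r hr hle
    rcases eq_fixed_of_lyapunov_eq (h r hr) hle with h | rfl | rfl
    exacts [h, (hp hr).elim, (hm hr).elim]
  have hb0 := key b hb (hmin (bmap_mem_of_image_eq hM (bmap_mem_of_image_eq hM hb)))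
  have ha0 : a = 0 := by
    have ha' := bmap_symm_mem_of_image_eq hM (bmap_symm_mem_of_image_eq hM ha)
    have := key _ ha' (by simpa only [Equiv.apply_symm_apply] using isMaxOn_iff.1 hmax _ ha')
    rwa [Equiv.symm_apply_eq, h0, Equiv.symm_apply_eq, h0] at this
  refine key q hq ?_
  have h1 : lyapunov q ≤ lyapunov a := hmax hq
  have h2 : lyapunov b ≤ lyapunov (bmap ℝ (bmap ℝ q)) :=
    hmin (bmap_mem_of_image_eq hM (bmap_mem_of_image_eq hM hq))
  rw [ha0] at h1
  rw [hb0] at h2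
  exact h1.trans h2

end Invariant

/-! ### Limit sets of orbits -/

section LimitSet

variable {X : Type*}

/-- The set of limit points of the forward orbit of `q` under `T`. -/
def limitSet [TopologicalSpace X] (T : X → X) (q : X) : Set X :=
  {a | MapClusterPt a atTop fun n : ℕ => T^[n] q}

theorem limitSet_subset [TopologicalSpace X] {T : X → X} {q : X} {A : Set X} (hA : IsClosed A)
    {N : ℕ} (h : ∀ n ≥ N, T^[n] q ∈ A) : limitSet T q ⊆ A := fun _ ha =>
  hA.mem_of_mapClusterPt ha (eventually_atTop.2 ⟨N, h⟩)

theorem exists_iterate_mem [TopologicalSpace X] {T : X → X} {q a : X} (ha : a ∈ limitSet T q)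
    {U : Set X} (hU : U ∈ 𝓝 a) (N : ℕ) : ∃ n ≥ N, T^[n] q ∈ U :=
  frequently_atTop.1 (mapClusterPt_iff_frequently.1 ha U hU) N

theorem image_limitSet [TopologicalSpace X] {T : X ≃ X} (hT : Continuous T)
    (hT' : Continuous T.symm) (q : X) : T '' limitSet T q = limitSet T q := by
  apply Subset.antisymm
  · rintro _ ⟨a, ha, rfl⟩
    have h := ha.continuousAt_comp hT.continuousAt
    refine MapClusterPt.of_comp (φ := fun n => n + 1) (tendsto_add_atTop_nat 1) ?_
    simpa only [Function.comp_def, Function.iterate_succ_apply'] using h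
  · intro a ha
    refine ⟨T.symm a, ?_, T.apply_symm_apply a⟩
    have h := MapClusterPt.continuousAt_comp hT'.continuousAt ha
    refine MapClusterPt.of_comp (φ := fun n => n - 1) (tendsto_sub_atTop_nat 1) ?_
    refine (Filter.EventuallyEq.mapClusterPt_iff ?_).1 h
    filter_upwards [eventually_ge_atTop 1] with n hn
    obtain ⟨m, rfl⟩ := Nat.exists_eq_add_of_le' hn
    simp [Function.iterate_succ_apply', -Function.iterate_succ]

variable [PseudoMetricSpace X] [ProperSpace X] {T : X → X} {q : X}

theorem isCompact_limitSet (h : Bornology.IsBounded (range fun n : ℕ => T^[n] q)) :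
    IsCompact (limitSet T q) := by
  refine Metric.isCompact_of_isClosed_isBounded isClosed_setOfPred_clusterPt ?_
  exact h.closure.subset (limitSet_subset isClosed_closure (N := 0)
    fun n _ => subset_closure (mem_range_self n))

theorem tendsto_infDist_of_limitSet_subset
    (h : Bornology.IsBounded (range fun n : ℕ => T^[n] q)) {A : Set X}
    (hA : limitSet T q ⊆ A) :
    Tendsto (fun n : ℕ => Metric.infDist (T^[n] q) A) atTop (𝓝 0) := by
  rw [Metric.tendsto_atTop]
  by_contra! hcon
  obtain ⟨ε, hε, hf⟩ := hcon
  have hfr : ∃ᶠ n in atTop, T^[n] q ∈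
      closure (range fun n : ℕ => T^[n] q) ∩ {x | ε ≤ Metric.infDist x A} := by
    refine frequently_atTop.2 fun N => ?_
    obtain ⟨n, hn, hd⟩ := hf N
    refine ⟨n, hn, subset_closure (mem_range_self n), ?_⟩
    rwa [Real.dist_0_eq_abs, abs_of_nonneg Metric.infDist_nonneg] at hd
  have hcpt : IsCompact
      (closure (range fun n : ℕ => T^[n] q) ∩ {x | ε ≤ Metric.infDist x A}) :=
    h.isCompact_closure.inter_right
      (isClosed_le continuous_const (Metric.continuous_infDist_pt A))
  obtain ⟨a, ha, hca⟩ := hcpt.exists_mapClusterPt_of_frequently hfr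
  have h1 : ε ≤ Metric.infDist a A := ha.2
  rw [Metric.infDist_zero_of_mem (hA hca)] at h1
  exact h1.not_gt hε

end LimitSet

/-! ### Bounded orbits in the real plane -/

theorem tendsto_of_iterate {X : Type*} [TopologicalSpace X] {T : X → X} {q a : X} {N : ℕ}
    (h : Tendsto (fun n : ℕ => T^[n] (T^[N] q)) atTop (𝓝 a)) :
    Tendsto (fun n : ℕ => T^[n] q) atTop (𝓝 a) := by
  simp only [← Function.iterate_add_apply] at h
  exact (tendsto_add_atTop_iff_nat N).1 h

theorem tendsto_fixPlus_of_mem_limitSet {q : ℝ × ℝ} (h : fixPlus ∈ limitSet (bmap ℝ) q) :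
    Tendsto (fun n : ℕ => (bmap ℝ)^[n] q) atTop (𝓝 fixPlus) := by
  obtain ⟨n, -, hn⟩ := exists_iterate_mem h (Metric.closedBall_mem_nhds _ (by norm_num : (0 : ℝ) < 1 / 10)) 0
  exact tendsto_of_iterate
    (tendsto_bmap_iterate_of_norm_le (by rwa [Metric.mem_closedBall, dist_eq_norm] at hn))

theorem neg_fixMinus : -fixMinus = fixPlus := by
  ext <;> norm_num [fixMinus, fixPlus]

theorem neg_mem_limitSet {q a : ℝ × ℝ} (h : a ∈ limitSet (bmap ℝ) q) :
    -a ∈ limitSet (bmap ℝ) (-q) := by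
  have := MapClusterPt.continuousAt_comp (f := Neg.neg) continuous_neg.continuousAt h
  simpa only [limitSet, mem_ofPred_eq, Function.comp_def, bmap_iterate_neg] using this

theorem neg_mem_limitSet_symm {q a : ℝ × ℝ} (h : a ∈ limitSet (bmap ℝ).symm q) :
    -a ∈ limitSet (bmap ℝ).symm (-q) := by
  have := MapClusterPt.continuousAt_comp (f := Neg.neg) continuous_neg.continuousAt h
  simpa only [limitSet, mem_ofPred_eq, Function.comp_def, bmap_symm_iterate_neg] using this

theorem tendsto_fixMinus_of_mem_limitSet {q : ℝ × ℝ} (h : fixMinus ∈ limitSet (bmap ℝ) q) :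
    Tendsto (fun n : ℕ => (bmap ℝ)^[n] q) atTop (𝓝 fixMinus) := by
  have h1 := neg_mem_limitSet h
  rw [neg_fixMinus] at h1
  have h2 := (tendsto_fixPlus_of_mem_limitSet h1).neg
  simpa only [bmap_iterate_neg, neg_neg, ← neg_fixMinus] using h2

/-- The limit set is compact and invariant. If it meets the open square, some iterate enters a
smaller forward invariant square, so the whole limit set lies there and then in the square of radius
1/2. If it also misses the two attracting points, it reduces to the origin. -/
theorem bounded_forward_orbit {q : ℝ × ℝ}
    (hb : Bornology.IsBounded (range fun n : ℕ => (bmap ℝ)^[n] q)) :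
    Tendsto (fun n : ℕ => (bmap ℝ)^[n] q) atTop (𝓝 fixPlus) ∨
    Tendsto (fun n : ℕ => (bmap ℝ)^[n] q) atTop (𝓝 fixMinus) ∨ q ∈ Ws {0} ∨ q ∈ Ws {p, p'} := by
  have hc := isCompact_limitSet hb
  have hM := image_limitSet (T := bmap ℝ) continuous_bmap continuous_bmap_symm q
  by_cases hex : ∀ a ∈ limitSet (bmap ℝ) q, corner ≤ ‖a‖
  · exact .inr (.inr (.inr
      (tendsto_infDist_of_limitSet_subset hb (subset_pair_of_isCompact hc hM hex))))
  push Not at hex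
  obtain ⟨a, ha, hac⟩ := hex
  obtain ⟨N, -, hN⟩ := exists_iterate_mem ha
    (Metric.isOpen_ball.mem_nhds (mem_ball_zero_iff.2 hac)) 0
  rw [mem_ball_zero_iff] at hN
  have h12 : 1 / 2 < corner := by linarith [one_lt_corner]
  have hsub : limitSet (bmap ℝ) q ⊆ Metric.closedBall 0 (max ‖(bmap ℝ)^[N] q‖ (1 / 2)) := by
    refine limitSet_subset Metric.isClosed_closedBall (N := N) fun n hn => ?_
    obtain ⟨m, rfl⟩ := Nat.exists_eq_add_of_le' hn
    rw [mem_closedBall_zero_iff, Function.iterate_add_apply]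
    exact norm_bmap_iterate_le (le_max_right _ _) (max_le hN.le h12.le) (le_max_left _ _) m
  have hhalf : ∀ b ∈ limitSet (bmap ℝ) q, ‖b‖ ≤ 1 / 2 := fun b hb' =>
    norm_le_half_of_isCompact hc hM
      (fun d hd => (mem_closedBall_zero_iff.1 (hsub hd)).trans_lt (max_lt hN h12)) hb'
  by_cases hp : fixPlus ∈ limitSet (bmap ℝ) q
  · exact .inl (tendsto_fixPlus_of_mem_limitSet hp)
  by_cases hm : fixMinus ∈ limitSet (bmap ℝ) q
  · exact .inr (.inl (tendsto_fixMinus_of_mem_limitSet hm))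
  exact .inr (.inr (.inl
    (tendsto_infDist_of_limitSet_subset hb (subset_zero_of_isCompact hc hM hhalf hp hm))))

theorem iterate_symm_iterate {X : Type*} (T : X ≃ X) (n : ℕ) (q : X) :
    T^[n] (T.symm^[n] q) = q :=
  (Function.RightInverse.iterate T.right_inv n) q

/-- If the backward orbit comes within ε of the attracting point, iterating forward does not leave
that ball, so q itself is within ε. -/
theorem eq_fixPlus_of_mem_limitSet {q : ℝ × ℝ} (h : fixPlus ∈ limitSet (bmap ℝ).symm q) :
    q = fixPlus := by
  rw [← sub_eq_zero, ← norm_le_zero_iff]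
  refine le_of_forall_pos_le_add fun ε hε => ?_
  rw [zero_add]
  obtain ⟨n, -, hn⟩ := exists_iterate_mem h
    (Metric.closedBall_mem_nhds _ (lt_min hε (by norm_num : (0 : ℝ) < 1 / 10))) 0
  rw [Metric.mem_closedBall, dist_eq_norm] at hn
  have := norm_bmap_iterate_sub_le (min_le_right _ _) hn n
  rw [iterate_symm_iterate] at this
  exact this.trans (min_le_left _ _)

theorem eq_fixMinus_of_mem_limitSet {q : ℝ × ℝ} (h : fixMinus ∈ limitSet (bmap ℝ).symm q) :
    q = fixMinus := by
  have h1 := neg_mem_limitSet_symm h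
  rw [neg_fixMinus] at h1
  rw [← neg_inj, eq_fixPlus_of_mem_limitSet h1, neg_fixMinus]

theorem norm_iterate_symm_le {r : ℝ} (hr : 1 / 2 ≤ r) (hrc : r ≤ corner) {q : ℝ × ℝ} {m n : ℕ}
    (hmn : m ≤ n) (h : ‖(bmap ℝ).symm^[n] q‖ ≤ r) : ‖(bmap ℝ).symm^[m] q‖ ≤ r := by
  obtain ⟨k, rfl⟩ := Nat.exists_eq_add_of_le' hmn
  have := norm_bmap_iterate_le hr hrc h k
  rwa [Function.iterate_add_apply, iterate_symm_iterate] at this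

theorem image_limitSet_symm (q : ℝ × ℝ) :
    bmap ℝ '' limitSet (bmap ℝ).symm q = limitSet (bmap ℝ).symm q := by
  conv_lhs => rw [← image_limitSet (T := (bmap ℝ).symm) continuous_bmap_symm continuous_bmap q]
  exact (bmap ℝ).image_symm_image _

theorem bounded_backward_orbit {q : ℝ × ℝ}
    (hb : Bornology.IsBounded (range fun n : ℕ => (bmap ℝ).symm^[n] q)) :
    q = fixPlus ∨ q = fixMinus ∨ q ∈ Wu {0} ∨ q ∈ Wu {p, p'} := by
  have hc := isCompact_limitSet hb
  have hM := image_limitSet_symm q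
  by_cases hex : ∀ a ∈ limitSet (bmap ℝ).symm q, corner ≤ ‖a‖
  · exact .inr (.inr (.inr
      (tendsto_infDist_of_limitSet_subset hb (subset_pair_of_isCompact hc hM hex))))
  push Not at hex
  obtain ⟨a, ha, hac⟩ := hex
  have h12 : 1 / 2 < corner := by linarith [one_lt_corner]
  obtain ⟨r, hr1, hr2⟩ := exists_between (max_lt hac h12)
  rw [max_lt_iff] at hr1
  -- Backward orbits enter the square of radius r at arbitrarily late times; forward invariance then
  -- places all earlier backward iterates in it.
  have hsub : limitSet (bmap ℝ).symm q ⊆ Metric.closedBall 0 r := by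
    refine limitSet_subset Metric.isClosed_closedBall (N := 0) fun m _ => ?_
    obtain ⟨n, hmn, hn⟩ := exists_iterate_mem ha
      (Metric.isOpen_ball.mem_nhds (mem_ball_zero_iff.2 hr1.1)) m
    rw [mem_ball_zero_iff] at hn
    exact mem_closedBall_zero_iff.2 (norm_iterate_symm_le hr1.2.le hr2.le hmn hn.le)
  have hhalf : ∀ b ∈ limitSet (bmap ℝ).symm q, ‖b‖ ≤ 1 / 2 := fun b hb' =>
    norm_le_half_of_isCompact hc hM
      (fun d hd => (mem_closedBall_zero_iff.1 (hsub hd)).trans_lt hr2) hb'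
  by_cases hp : fixPlus ∈ limitSet (bmap ℝ).symm q
  · exact .inl (eq_fixPlus_of_mem_limitSet hp)
  by_cases hm : fixMinus ∈ limitSet (bmap ℝ).symm q
  · exact .inr (.inl (eq_fixMinus_of_mem_limitSet hm))
  exact .inr (.inr (.inl
    (tendsto_infDist_of_limitSet_subset hb (subset_zero_of_isCompact hc hM hhalf hp hm))))

/-! ### Stable and unstable sets -/

theorem bmap_zero : bmap ℝ 0 = 0 := by rw [bmap_apply]; simp

theorem bmap_fixPlus : bmap ℝ fixPlus = fixPlus := by
  rw [bmap_apply, fixPlus]; norm_num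

theorem bmap_fixMinus : bmap ℝ fixMinus = fixMinus := by
  rw [← neg_inj, ← bmap_neg, neg_fixMinus, bmap_fixPlus]

theorem mem_stableSet_singleton {g : ℝ × ℝ ≃ ℝ × ℝ} {a q : ℝ × ℝ} :
    q ∈ stableSet g {a} ↔ Tendsto (fun n : ℕ => g^[n] q) atTop (𝓝 a) := by
  simp only [stableSet, mem_ofPred_eq, Metric.infDist_singleton]
  exact tendsto_iff_dist_tendsto_zero.symm

theorem isBounded_range_of_mem_stableSet {g : ℝ × ℝ ≃ ℝ × ℝ} {A : Set (ℝ × ℝ)} {q : ℝ × ℝ}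
    (hA : A.Nonempty) (hb : Bornology.IsBounded A) (h : q ∈ stableSet g A) :
    Bornology.IsBounded (range fun n : ℕ => g^[n] q) := by
  obtain ⟨R, hR⟩ := hb.exists_norm_le
  obtain ⟨N, hN⟩ := eventually_atTop.1 (h.eventually (gt_mem_nhds zero_lt_one))
  have hsub : (range fun n : ℕ => g^[n] q) ⊆
      ((fun n : ℕ => g^[n] q) '' Iio N) ∪ Metric.closedBall 0 (R + 1) := by
    rintro _ ⟨n, rfl⟩
    rcases lt_or_ge n N with hn | hn
    · exact .inl (mem_image_of_mem _ hn)
    · obtain ⟨a, ha, had⟩ := (Metric.infDist_lt_iff hA).1 (hN n hn)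
      right
      rw [mem_closedBall_zero_iff]
      rw [dist_eq_norm] at had
      calc ‖g^[n] q‖ = ‖a + (g^[n] q - a)‖ := by congr 1; abel
        _ ≤ R + 1 := (norm_add_le _ _).trans (add_le_add (hR a ha) had.le)
  exact (((finite_Iio N).image _).isBounded.union Metric.isBounded_closedBall).subset hsub

theorem corner_sub_norm_le_infDist (q : ℝ × ℝ) : corner - ‖q‖ ≤ Metric.infDist q {p, p'} := by
  refine (Metric.le_infDist ⟨p, mem_insert _ _⟩).2 ?_
  rintro a (rfl | rfl)
  · rw [dist_eq_norm, ← norm_p]; linarith [norm_sub_norm_le p q, norm_sub_rev p q]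
  · rw [dist_eq_norm, ← norm_p']; linarith [norm_sub_norm_le p' q, norm_sub_rev p' q]

theorem notMem_stableSet_pair {g : ℝ × ℝ ≃ ℝ × ℝ} {q : ℝ × ℝ} {r : ℝ} {N : ℕ} (hr : r < corner)
    (h : ∀ n ≥ N, ‖g^[n] q‖ ≤ r) : q ∉ stableSet g {p, p'} := by
  intro hq
  obtain ⟨M, hM⟩ := eventually_atTop.1 (hq.eventually (gt_mem_nhds (sub_pos.2 hr)))
  have h1 := hM (max M N) (le_max_left _ _)
  have h2 := h (max M N) (le_max_right _ _)
  linarith [corner_sub_norm_le_infDist (g^[max M N] q)]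

theorem symm_iterate_iterate {X : Type*} (T : X ≃ X) (n : ℕ) (q : X) :
    T.symm^[n] (T^[n] q) = q :=
  (Function.LeftInverse.iterate T.left_inv n) q

theorem norm_iterate_symm_le_half_of_mem_Wu_zero {q : ℝ × ℝ} (h : q ∈ Wu {0}) (n : ℕ) :
    ‖(bmap ℝ).symm^[n] q‖ ≤ 1 / 2 := by
  have h1 := (mem_stableSet_singleton.1 h).norm
  rw [norm_zero] at h1
  obtain ⟨N, hN⟩ := eventually_atTop.1
    (h1.eventually (gt_mem_nhds (by norm_num : (0 : ℝ) < 1 / 2)))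
  exact norm_iterate_symm_le le_rfl (by linarith [one_lt_corner]) (le_max_left n N)
    (hN _ (le_max_right _ _)).le

theorem norm_iterate_le_half_of_mem_Wu_zero {q : ℝ × ℝ} (h : q ∈ Wu {0}) (n : ℕ) :
    ‖(bmap ℝ)^[n] q‖ ≤ 1 / 2 :=
  norm_bmap_iterate_le le_rfl (by linarith [one_lt_corner])
    (norm_iterate_symm_le_half_of_mem_Wu_zero h 0) n

theorem disjoint_Ws_pair_Wu_zero : Disjoint (Ws {p, p'}) (Wu {0}) :=
  disjoint_left.2 fun _ hs hu => notMem_stableSet_pair (r := 1 / 2) (N := 0)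
    (by linarith [one_lt_corner]) (fun n _ => norm_iterate_le_half_of_mem_Wu_zero hu n) hs

theorem lyapunov_iterate_le {q : ℝ × ℝ} (hq : ‖q‖ ≤ 1 / 2) (n : ℕ) :
    lyapunov ((bmap ℝ)^[n] q) ≤ lyapunov q := by
  induction n with
  | zero => exact le_rfl
  | succ n ih =>
    rw [Function.iterate_succ_apply']
    exact (lyapunov_bmap_le_self
      (norm_bmap_iterate_le le_rfl (by linarith [one_lt_corner]) hq n)).trans ih

theorem eq_of_isFixedPt_of_mem_Ws {a b : ℝ × ℝ} (ha : bmap ℝ a = a) (h : a ∈ Ws {b}) : a = b := by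
  have h1 := mem_stableSet_singleton.1 h
  simp only [Function.iterate_fixed ha] at h1
  exact tendsto_nhds_unique tendsto_const_nhds h1

theorem fixPlus_ne_zero : fixPlus ≠ 0 := by
  intro h
  have := congrArg Prod.fst h
  norm_num [fixPlus] at this

theorem fixMinus_ne_zero : fixMinus ≠ 0 := by
  rw [← neg_ne_zero, neg_fixMinus]; exact fixPlus_ne_zero

/-- The Lyapunov function does not increase along the orbit and tends to 0 at both ends, so it is
stationary and q is a fixed point. -/
theorem Ws_zero_inter_Wu_zero {q : ℝ × ℝ} (hs : q ∈ Ws {0}) (hu : q ∈ Wu {0}) : q = 0 := by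
  have h0 : lyapunov 0 = 0 := by simp [lyapunov]
  have hhalf := norm_iterate_le_half_of_mem_Wu_zero hu
  have h1 : lyapunov q ≤ 0 := by
    have := continuous_lyapunov.continuousAt.tendsto.comp (mem_stableSet_singleton.1 hu)
    rw [h0] at this
    refine ge_of_tendsto' this fun n => ?_
    have := lyapunov_iterate_le (norm_iterate_symm_le_half_of_mem_Wu_zero hu n) n
    rwa [iterate_symm_iterate] at this
  have h2 : 0 ≤ lyapunov (bmap ℝ (bmap ℝ q)) := by
    have := continuous_lyapunov.continuousAt.tendsto.comp
      ((tendsto_add_atTop_iff_nat 2).2 (mem_stableSet_singleton.1 hs))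
    rw [h0] at this
    exact le_of_tendsto' this fun n => lyapunov_iterate_le (hhalf 2) n
  rcases eq_fixed_of_lyapunov_eq (hhalf 0) (h1.trans h2) with h | rfl | rfl
  · exact h
  · exact eq_of_isFixedPt_of_mem_Ws bmap_fixPlus hs
  · exact eq_of_isFixedPt_of_mem_Ws bmap_fixMinus hs

/-! ### The full orbit of a point of `K` -/

/-- The closure of the full orbit is a compact invariant set. -/
theorem norm_le_corner_of_isBounded {q : ℝ × ℝ}
    (hf : Bornology.IsBounded (range fun n : ℕ => (bmap ℝ)^[n] q))
    (hb : Bornology.IsBounded (range fun n : ℕ => (bmap ℝ).symm^[n] q)) : ‖q‖ ≤ corner := by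
  set O := (range fun n : ℕ => (bmap ℝ)^[n] q) ∪ range fun n : ℕ => (bmap ℝ).symm^[n] q with hO
  have hOO : bmap ℝ '' O = O := by
    apply Subset.antisymm
    · rintro _ ⟨_, ⟨n, rfl⟩ | ⟨n, rfl⟩, rfl⟩
      · exact .inl ⟨n + 1, Function.iterate_succ_apply' _ _ _⟩
      · rcases n with _ | n
        · exact .inl ⟨1, rfl⟩
        · exact .inr ⟨n, by simp only [Function.iterate_succ_apply', Equiv.apply_symm_apply]⟩
    · rintro _ (⟨n, rfl⟩ | ⟨n, rfl⟩)
      · rcases n with _ | n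
        · exact ⟨(bmap ℝ).symm q, .inr ⟨1, rfl⟩, Equiv.apply_symm_apply _ _⟩
        · exact ⟨_, .inl ⟨n, rfl⟩, (Function.iterate_succ_apply' _ _ _).symm⟩
      · exact ⟨_, .inr ⟨n + 1, rfl⟩, by
          simp only [Function.iterate_succ_apply', Equiv.apply_symm_apply]⟩
  have hcl : bmap ℝ '' closure O = closure O := by
    let T : ℝ × ℝ ≃ₜ ℝ × ℝ := ⟨bmap ℝ, continuous_bmap, continuous_bmap_symm⟩
    have := T.image_closure O
    rw [show T '' O = O from hOO] at this
    exact this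
  exact norm_le_corner_of_isCompact (hf.union hb).isCompact_closure hcl
    (subset_closure (.inl ⟨0, rfl⟩))

theorem norm_bmap_bmap_lt_corner_of_isBounded {q : ℝ × ℝ}
    (hf : Bornology.IsBounded (range fun n : ℕ => (bmap ℝ)^[n] q))
    (hb : Bornology.IsBounded (range fun n : ℕ => (bmap ℝ).symm^[n] q))
    (hp : q ≠ p) (hp' : q ≠ p') : ‖bmap ℝ (bmap ℝ q)‖ < corner :=
  norm_bmap_bmap_lt_corner (norm_le_corner_of_isBounded hf hb) hp hp'

theorem isBounded_range_iterate {q : ℝ × ℝ} (hq : ‖q‖ ≤ corner) :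
    Bornology.IsBounded (range fun n : ℕ => (bmap ℝ)^[n] q) := by
  refine isBounded_iff_forall_norm_le.2 ⟨corner, ?_⟩
  rintro _ ⟨n, rfl⟩
  exact norm_bmap_iterate_le (by linarith [one_lt_corner]) le_rfl hq n

theorem Ws_pair_inter_Wu_pair {q : ℝ × ℝ} (hs : q ∈ Ws {p, p'}) (hu : q ∈ Wu {p, p'}) :
    q = p ∨ q = p' := by
  by_contra! h
  have hb : Bornology.IsBounded ({p, p'} : Set (ℝ × ℝ)) := (toFinite _).isBounded
  have h1 := norm_bmap_bmap_lt_corner_of_isBounded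
    (isBounded_range_of_mem_stableSet ⟨p, mem_insert _ _⟩ hb hs)
    (isBounded_range_of_mem_stableSet ⟨p, mem_insert _ _⟩ hb hu) h.1 h.2
  have h12 : 1 / 2 < corner := by linarith [one_lt_corner]
  refine notMem_stableSet_pair (max_lt h1 h12) (N := 2) (fun n hn => ?_) hs
  obtain ⟨m, rfl⟩ := Nat.exists_eq_add_of_le' hn
  rw [Function.iterate_add_apply]
  exact norm_bmap_iterate_le (le_max_right _ _) (max_lt h1 h12).le (le_max_left _ _) m

/-! ### The attracting points are limits of the unstable set of the origin -/

theorem image_iterate_closedBall_antitone :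
    Antitone fun n : ℕ => (bmap ℝ)^[n] '' Metric.closedBall (0 : ℝ × ℝ) (1 / 2) := by
  refine antitone_nat_of_succ_le fun n => ?_
  rintro _ ⟨a, ha, rfl⟩
  refine ⟨bmap ℝ a, ?_, rfl⟩
  rw [mem_closedBall_zero_iff] at *
  exact norm_bmap_le le_rfl (by linarith [one_lt_corner]) ha

/-- The images of the small square under the iterates of f are nested, compact, connected, and
contain both 0 and p₊, which are at distance 1/2. So they share a point of the sphere of radius r
about p₊. Its backward orbit stays in the small square, and the classification of backward orbits
leaves only the unstable set of 0, since p₋ is at distance 1 from p₊. -/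
theorem exists_mem_Wu_zero_norm_sub_eq {r : ℝ} (hr : 0 < r) (hr' : r < 1 / 2) :
    ∃ q ∈ Wu {0}, ‖q - fixPlus‖ = r := by
  set B := Metric.closedBall (0 : ℝ × ℝ) (1 / 2) with hB
  have hfix : ‖fixPlus‖ = 1 / 2 := by
    rw [fixPlus, Prod.norm_mk, max_self]; norm_num
  have hcont : ∀ n : ℕ, Continuous (bmap ℝ)^[n] := fun n => continuous_bmap.iterate n
  have hne : ∀ n : ℕ, ((bmap ℝ)^[n] '' B ∩ Metric.sphere fixPlus r).Nonempty := by
    intro n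
    have hpc : IsPreconnected ((bmap ℝ)^[n] '' B) :=
      (convex_closedBall (0 : ℝ × ℝ) (1 / 2)).isPreconnected.image _ (hcont n).continuousOn
    have h1 : fixPlus ∈ (bmap ℝ)^[n] '' B :=
      ⟨fixPlus, by rw [hB, mem_closedBall_zero_iff, hfix], Function.iterate_fixed bmap_fixPlus n⟩
    have h2 : (0 : ℝ × ℝ) ∈ (bmap ℝ)^[n] '' B :=
      ⟨0, by rw [hB, mem_closedBall_zero_iff]; simp, Function.iterate_fixed bmap_zero n⟩
    obtain ⟨a, ha, har⟩ := hpc.intermediate_value h1 h2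
      (f := fun a => ‖a - fixPlus‖) (by fun_prop)
      (show r ∈ Icc _ _ by rw [sub_self, norm_zero, zero_sub, norm_neg, hfix]; exact ⟨hr.le, hr'.le⟩)
    exact ⟨a, ha, by rwa [mem_sphere_iff_norm]⟩
  have hcpt : ∀ n : ℕ, IsCompact ((bmap ℝ)^[n] '' B) := fun n =>
    (isCompact_closedBall _ _).image (hcont n)
  obtain ⟨q, hq⟩ := IsCompact.nonempty_iInter_of_sequence_nonempty_isCompact_isClosed
    (fun n : ℕ => (bmap ℝ)^[n] '' B ∩ Metric.sphere fixPlus r)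
    (fun n => inter_subset_inter_left _ (image_iterate_closedBall_antitone n.le_succ)) hne
    ((hcpt 0).inter_right Metric.isClosed_sphere)
    (fun n => (hcpt n).isClosed.inter Metric.isClosed_sphere)
  rw [mem_iInter] at hq
  have hqr : ‖q - fixPlus‖ = r := mem_sphere_iff_norm.1 (hq 0).2
  have hback : ∀ n : ℕ, ‖(bmap ℝ).symm^[n] q‖ ≤ 1 / 2 := by
    intro n
    obtain ⟨a, ha, rfl⟩ := (hq n).1
    rw [symm_iterate_iterate]
    exact mem_closedBall_zero_iff.1 ha
  refine ⟨q, ?_, hqr⟩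
  rcases bounded_backward_orbit (q := q) (isBounded_iff_forall_norm_le.2
    ⟨1 / 2, by rintro _ ⟨n, rfl⟩; exact hback n⟩) with rfl | rfl | h | h
  · rw [sub_self, norm_zero] at hqr; exact (hr.ne hqr).elim
  · exfalso
    rw [← neg_fixMinus] at hqr
    have h1 : ‖fixMinus - -fixMinus‖ = 1 := by
      rw [fixMinus, Prod.neg_mk, Prod.mk_sub_mk, Prod.norm_mk, max_self]; norm_num
    linarith
  · exact h
  · exact (notMem_stableSet_pair (r := 1 / 2) (N := 0) (by linarith [one_lt_corner])
      (fun n _ => hback n) h).elim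

theorem fixPlus_mem_closure_Wu_zero : fixPlus ∈ closure (Wu {0}) := by
  rw [Metric.mem_closure_iff]
  intro ε hε
  obtain ⟨q, hq, hqr⟩ := exists_mem_Wu_zero_norm_sub_eq
    (r := min (ε / 2) (1 / 4)) (by positivity) ((min_le_right _ _).trans_lt (by norm_num))
  refine ⟨q, hq, ?_⟩
  rw [dist_comm, dist_eq_norm, hqr]
  linarith [min_le_left (ε / 2) (1 / 4)]

theorem neg_mem_Wu_zero {q : ℝ × ℝ} (h : q ∈ Wu {0}) : -q ∈ Wu {0} := by
  have := (mem_stableSet_singleton.1 h).neg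
  simp only [neg_zero] at this
  refine mem_stableSet_singleton.2 ?_
  simpa only [bmap_symm_iterate_neg] using this

theorem fixMinus_mem_closure_Wu_zero : fixMinus ∈ closure (Wu {0}) := by
  have := map_mem_closure continuous_neg fixPlus_mem_closure_Wu_zero fun _ => neg_mem_Wu_zero
  rwa [← neg_fixMinus, neg_neg] at this

/-! ### Orbits as solutions of a cubic recurrence of order two -/

/-- The solution of `x (n + 2) = a x n + b x (n + 1) + c x (n + 1) ^ 3` with initial values `z`. -/
def cubicSeq (a b c : ℂ) (z : ℂ × ℂ) : ℕ → ℂ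
  | 0 => z.1
  | 1 => z.2
  | n + 2 => a * cubicSeq a b c z n + b * cubicSeq a b c z (n + 1)
      + c * cubicSeq a b c z (n + 1) ^ 3

/-- The solution with initial values `v` of the linearization of the cubic recurrence along the
solution with initial values `z`. -/
def tangentSeq (a b c : ℂ) (z v : ℂ × ℂ) : ℕ → ℂ
  | 0 => v.1
  | 1 => v.2
  | n + 2 => a * tangentSeq a b c z v n
      + (b + 3 * c * cubicSeq a b c z (n + 1) ^ 2) * tangentSeq a b c z v (n + 1)

/-- The initial values of the bounded solutions of the cubic recurrence. -/
def boundedSolutions (a b c : ℂ) : Set (ℂ × ℂ) :=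
  {z | ∃ R, ∀ n, ‖cubicSeq a b c z n‖ ≤ R}

section Recurrence

variable {a b c : ℂ} {z : ℂ × ℂ}

theorem continuous_cubicSeq (n : ℕ) : Continuous fun z => cubicSeq a b c z n := by
  induction n using Nat.twoStepInduction with
  | zero => exact continuous_fst
  | one => exact continuous_snd
  | more n h0 h1 => simp only [cubicSeq]; fun_prop

/-- For |y| ≥ 2 the cubic term has modulus at least 4 |c| |y|, which beats the linear terms by 2
|y|. -/
theorem two_mul_norm_cubicSeq_le (h : ‖a‖ + ‖b‖ + 2 ≤ 4 * ‖c‖) {n : ℕ}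
    (h1 : ‖cubicSeq a b c z n‖ ≤ ‖cubicSeq a b c z (n + 1)‖) (h2 : 2 ≤ ‖cubicSeq a b c z (n + 1)‖) :
    2 * ‖cubicSeq a b c z (n + 1)‖ ≤ ‖cubicSeq a b c z (n + 2)‖ := by
  set x := cubicSeq a b c z n
  set y := cubicSeq a b c z (n + 1)
  have h3 : c * y ^ 3 = cubicSeq a b c z (n + 2) - (a * x + b * y) := by
    simp only [cubicSeq, x, y]; ring
  have h4 : ‖c‖ * ‖y‖ ^ 3 ≤ ‖cubicSeq a b c z (n + 2)‖ + (‖a‖ * ‖x‖ + ‖b‖ * ‖y‖) := by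
    rw [← norm_pow, ← norm_mul, h3, ← norm_mul, ← norm_mul]
    exact (norm_sub_le _ _).trans (by gcongr; exact norm_add_le _ _)
  have h5 : ‖a‖ * ‖x‖ ≤ ‖a‖ * ‖y‖ := by gcongr
  have h6 : ‖c‖ * (4 * ‖y‖) ≤ ‖c‖ * ‖y‖ ^ 3 := by
    gcongr
    nlinarith [mul_nonneg (by linarith : 0 ≤ ‖y‖) (by nlinarith : 0 ≤ ‖y‖ ^ 2 - 4)]
  nlinarith [mul_le_mul_of_nonneg_right h (norm_nonneg y)]

theorem norm_cubicSeq_ge (h : ‖a‖ + ‖b‖ + 2 ≤ 4 * ‖c‖) {n : ℕ}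
    (hn : max ‖cubicSeq a b c z n‖ 2 < ‖cubicSeq a b c z (n + 1)‖) (k : ℕ) :
    ‖cubicSeq a b c z (n + k)‖ ≤ ‖cubicSeq a b c z (n + k + 1)‖ ∧
      2 * 2 ^ k ≤ ‖cubicSeq a b c z (n + k + 1)‖ := by
  rw [max_lt_iff] at hn
  induction k with
  | zero => exact ⟨hn.1.le, by simpa using hn.2.le⟩
  | succ k ih =>
    have h2 : (1 : ℝ) ≤ 2 ^ k := one_le_pow₀ (by norm_num)
    have := two_mul_norm_cubicSeq_le h ih.1 (by linarith [ih.2])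
    rw [show n + (k + 1) = n + k + 1 by ring, pow_succ]
    exact ⟨by linarith [norm_nonneg (cubicSeq a b c z (n + k + 1))], by linarith [ih.2]⟩

theorem norm_cubicSeq_le_of_forall
    (h : ∀ n, ‖cubicSeq a b c z (n + 1)‖ ≤ max ‖cubicSeq a b c z n‖ 2) (n : ℕ) :
    ‖cubicSeq a b c z n‖ ≤ max ‖z‖ 2 := by
  induction n with
  | zero => exact le_max_of_le_left (norm_fst_le z)
  | succ n ih => exact (h n).trans (max_le ih (le_max_right _ _))

/-- Escape criterion: a first growth beyond the threshold 2 starts doubling forever. Boundedness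
thus becomes a family of closed conditions, and it comes with a bound depending only on the norm of
the initial values. -/
theorem mem_boundedSolutions_iff (h : ‖a‖ + ‖b‖ + 2 ≤ 4 * ‖c‖) :
    z ∈ boundedSolutions a b c ↔
      ∀ n, ‖cubicSeq a b c z (n + 1)‖ ≤ max ‖cubicSeq a b c z n‖ 2 := by
  refine ⟨fun ⟨R, hR⟩ n => ?_, fun h' => ⟨_, norm_cubicSeq_le_of_forall h'⟩⟩
  by_contra! hn
  obtain ⟨k, hk⟩ := pow_unbounded_of_one_lt R (by norm_num : (1 : ℝ) < 2)
  have h1 := (norm_cubicSeq_ge h hn k).2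
  have h2 := hR (n + k + 1)
  linarith [(by positivity : (0 : ℝ) < 2 ^ k)]

theorem isClosed_boundedSolutions (h : ‖a‖ + ‖b‖ + 2 ≤ 4 * ‖c‖) :
    IsClosed (boundedSolutions a b c) := by
  have : boundedSolutions a b c =
      ⋂ n, {z | ‖cubicSeq a b c z (n + 1)‖ ≤ max ‖cubicSeq a b c z n‖ 2} := by
    ext z; rw [mem_boundedSolutions_iff h, mem_iInter]; rfl
  rw [this]
  exact isClosed_iInter fun n => isClosed_le (continuous_cubicSeq _).norm
    ((continuous_cubicSeq _).norm.max continuous_const)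

theorem differentiable_cubicSeq_line (v : ℂ × ℂ) (n : ℕ) :
    Differentiable ℂ fun t : ℂ => cubicSeq a b c (z + t • v) n := by
  induction n using Nat.twoStepInduction with
  | zero => simp only [cubicSeq, Prod.fst_add, Prod.smul_fst, smul_eq_mul]; fun_prop
  | one => simp only [cubicSeq, Prod.snd_add, Prod.smul_snd, smul_eq_mul]; fun_prop
  | more n h0 h1 => simp only [cubicSeq]; fun_prop

theorem hasDerivAt_cubicSeq_line (v : ℂ × ℂ) (n : ℕ) :
    HasDerivAt (fun t : ℂ => cubicSeq a b c (z + t • v) n) (tangentSeq a b c z v n) 0 := by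
  induction n using Nat.twoStepInduction with
  | zero =>
    simp only [cubicSeq, tangentSeq, Prod.fst_add, Prod.smul_fst, smul_eq_mul]
    simpa using ((hasDerivAt_id (0 : ℂ)).mul_const v.1).const_add z.1
  | one =>
    simp only [cubicSeq, tangentSeq, Prod.snd_add, Prod.smul_snd, smul_eq_mul]
    simpa using ((hasDerivAt_id (0 : ℂ)).mul_const v.2).const_add z.2
  | more n h0 h1 =>
    simp only [cubicSeq, tangentSeq]
    refine (((h0.const_mul a).fun_add (h1.const_mul b)).fun_add
      ((h1.fun_pow 3).const_mul c)).congr_deriv ?_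
    simp only [zero_smul, add_zero]
    push_cast
    ring

/-- Cauchy's estimate: derivatives of the solution with respect to initial values are bounded in
the interior of the set of initial values of bounded solutions. -/
theorem exists_norm_tangentSeq_le (h : ‖a‖ + ‖b‖ + 2 ≤ 4 * ‖c‖)
    (hz : z ∈ interior (boundedSolutions a b c)) (v : ℂ × ℂ) :
    ∃ C, ∀ n, ‖tangentSeq a b c z v n‖ ≤ C := by
  have hcont : ContinuousAt (fun t : ℂ => z + t • v) 0 := by fun_prop
  have hnhds : (fun t : ℂ => z + t • v) ⁻¹' boundedSolutions a b c ∈ 𝓝 (0 : ℂ) :=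
    hcont.preimage_mem_nhds (by simpa using mem_interior_iff_mem_nhds.1 hz)
  obtain ⟨r, hr, hsub⟩ := Metric.nhds_basis_closedBall.mem_iff.1 hnhds
  refine ⟨max (‖z‖ + r * ‖v‖) 2 / r, fun n => ?_⟩
  rw [← (hasDerivAt_cubicSeq_line v n).deriv]
  refine Complex.norm_deriv_le_of_forall_mem_sphere_norm_le hr
    (differentiable_cubicSeq_line v n).diffContOnCl fun t ht => ?_
  have hmem := hsub (Metric.sphere_subset_closedBall ht)
  refine (norm_cubicSeq_le_of_forall ((mem_boundedSolutions_iff h).1 hmem) n).trans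
    (max_le_max ?_ le_rfl)
  refine (norm_add_le _ _).trans ?_
  rw [norm_smul, mem_sphere_zero_iff_norm.1 ht]

/-- This is the Jacobian determinant of the n-th iterate; one step of the recurrence has determinant
-a. -/
theorem tangentSeq_wronskian (n : ℕ) :
    tangentSeq a b c z (1, 0) n * tangentSeq a b c z (0, 1) (n + 1) -
      tangentSeq a b c z (1, 0) (n + 1) * tangentSeq a b c z (0, 1) n = (-a) ^ n := by
  induction n with
  | zero => simp [tangentSeq]
  | succ n ih => rw [pow_succ, ← ih]; simp only [tangentSeq]; ring

/-- At an interior point both tangent solutions are bounded, hence so is their Wronskian, whose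
modulus is |a|ⁿ. -/
theorem interior_boundedSolutions_eq_empty (h : ‖a‖ + ‖b‖ + 2 ≤ 4 * ‖c‖) (ha : 1 < ‖a‖) :
    interior (boundedSolutions a b c) = ∅ := by
  rw [eq_empty_iff_forall_notMem]
  intro z hz
  obtain ⟨C, hC⟩ := exists_norm_tangentSeq_le h hz (1, 0)
  obtain ⟨D, hD⟩ := exists_norm_tangentSeq_le h hz (0, 1)
  obtain ⟨n, hn⟩ := pow_unbounded_of_one_lt (C * D + C * D) ha
  have h1 : ‖(-a) ^ n‖ ≤ C * D + C * D := by
    rw [← tangentSeq_wronskian (b := b) (c := c) (z := z) n]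
    refine (norm_sub_le _ _).trans ?_
    have hC0 : 0 ≤ C := (norm_nonneg _).trans (hC 0)
    rw [norm_mul, norm_mul]
    exact add_le_add (mul_le_mul (hC _) (hD _) (norm_nonneg _) hC0)
      (mul_le_mul (hC _) (hD _) (norm_nonneg _) hC0)
  rw [norm_pow, norm_neg] at h1
  linarith

/-- A direction is expanded along an orbit on which the coefficient `b + 3 c x²` of the linearized
recurrence keeps a sign `ε` and is bounded below. -/
theorem tangentSeq_growth {ε : ℝ} (hε : ε * ε = 1) {d : ℕ → ℝ}
    (hd : ∀ n, b + 3 * c * cubicSeq a b c z (n + 1) ^ 2 = (d n : ℂ))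
    (hdε : ∀ n, 7 / 10 ≤ ε * d n) (ha : a = 1 / 2) (k : ℕ) :
    ∃ α β : ℝ, tangentSeq a b c z (1, ε) (2 * k) = α ∧
      tangentSeq a b c z (1, ε) (2 * k + 1) = (ε * β : ℝ) ∧
      (6 / 5) ^ k ≤ α ∧ (6 / 5) ^ k ≤ β := by
  induction k with
  | zero => exact ⟨1, 1, by simp [tangentSeq], by simp [tangentSeq], by simp, by simp⟩
  | succ k ih =>
    obtain ⟨α, β, h1, h2, hα, hβ⟩ := ih
    -- The factor 6/5 is 1/2 + 7/10: the contribution of a plus the lower bound on ε d.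
    have hpos : (0 : ℝ) < (6 / 5) ^ k := by positivity
    have hα' : (6 / 5) ^ (k + 1) ≤ α / 2 + ε * d (2 * k) * β := by
      rw [pow_succ]
      nlinarith [mul_le_mul (hdε (2 * k)) hβ hpos.le (by linarith [hdε (2 * k)])]
    refine ⟨α / 2 + ε * d (2 * k) * β, β / 2 + ε * d (2 * k + 1) *
      (α / 2 + ε * d (2 * k) * β), ?_, ?_, hα', ?_⟩
    · rw [show 2 * (k + 1) = 2 * k + 2 by ring]
      simp only [tangentSeq]
      rw [hd, h1, h2, ha]
      push_cast
      ring
    · rw [show 2 * (k + 1) + 1 = 2 * k + 1 + 2 by ring]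
      simp only [tangentSeq]
      rw [hd (2 * k + 1), hd, h1, h2, ha]
      have hε' : (ε : ℂ) * ε = 1 := by exact_mod_cast hε
      push_cast
      linear_combination (-(d (2 * k + 1) : ℂ) * (α / 2 + ε * d (2 * k) * β)) * hε'
    · have h3 : (6 / 5 : ℝ) ^ k ≤ (6 / 5) ^ (k + 1) :=
        pow_le_pow_right₀ (by norm_num) k.le_succ
      have h4 := mul_le_mul (hdε (2 * k + 1)) (h3.trans hα') hpos.le
        (by linarith [hdε (2 * k + 1)])
      rw [pow_succ]
      linarith

theorem notMem_interior_boundedSolutions (h : ‖a‖ + ‖b‖ + 2 ≤ 4 * ‖c‖) {ε : ℝ} (hε : ε * ε = 1)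
    {d : ℕ → ℝ} (hd : ∀ n, b + 3 * c * cubicSeq a b c z (n + 1) ^ 2 = (d n : ℂ))
    (hdε : ∀ n, 7 / 10 ≤ ε * d n) (ha : a = 1 / 2) : z ∉ interior (boundedSolutions a b c) := by
  intro hz
  obtain ⟨C, hC⟩ := exists_norm_tangentSeq_le h hz (1, ε)
  obtain ⟨k, hk⟩ := pow_unbounded_of_one_lt C (by norm_num : (1 : ℝ) < 6 / 5)
  obtain ⟨α, β, h1, -, hα, -⟩ := tangentSeq_growth hε hd hdε ha k
  have h2 := hC (2 * k)
  rw [h1, Complex.norm_real] at h2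
  linarith [le_abs_self α, Real.norm_eq_abs α]

end Recurrence

/-! ### The filled Julia sets in `ℂ²` -/

theorem bmap_iterate_eq_cubicSeq (z : ℂ × ℂ) (n : ℕ) :
    (bmap ℂ)^[n] z =
      (cubicSeq (1 / 2) (3 / 4) (-1) z n, cubicSeq (1 / 2) (3 / 4) (-1) z (n + 1)) := by
  induction n with
  | zero => rfl
  | succ n ih =>
    rw [Function.iterate_succ_apply', ih, bmap_apply]
    ext
    · rfl
    · simp only [cubicSeq]; ring

theorem bmap_symm_iterate_eq_cubicSeq (z : ℂ × ℂ) (n : ℕ) :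
    (bmap ℂ).symm^[n] z =
      (cubicSeq 2 (-3 / 2) 2 z.swap (n + 1), cubicSeq 2 (-3 / 2) 2 z.swap n) := by
  induction n with
  | zero => rfl
  | succ n ih =>
    rw [Function.iterate_succ_apply', ih, bmap_symm_apply]
    ext
    · simp only [cubicSeq]; ring
    · rfl

theorem KPlus_eq : KPlus = boundedSolutions (1 / 2) (3 / 4) (-1) := by
  ext z
  simp only [KPlus, boundedSolutions, mem_ofPred_eq, isBounded_iff_forall_norm_le,
    forall_mem_range, bmap_iterate_eq_cubicSeq, Prod.norm_mk, max_le_iff]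
  exact ⟨fun ⟨R, hR⟩ => ⟨R, fun n => (hR n).1⟩, fun ⟨R, hR⟩ => ⟨R, fun n => ⟨hR n, hR _⟩⟩⟩

theorem KMinus_eq : KMinus = Prod.swap ⁻¹' boundedSolutions 2 (-3 / 2) 2 := by
  ext z
  simp only [KMinus, boundedSolutions, mem_ofPred_eq, mem_preimage, isBounded_iff_forall_norm_le,
    forall_mem_range, bmap_symm_iterate_eq_cubicSeq, Prod.norm_mk, max_le_iff]
  exact ⟨fun ⟨R, hR⟩ => ⟨R, fun n => (hR n).2⟩, fun ⟨R, hR⟩ => ⟨R, fun n => ⟨hR _, hR n⟩⟩⟩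

theorem forward_coeff_bound :
    ‖(1 / 2 : ℂ)‖ + ‖(3 / 4 : ℂ)‖ + 2 ≤ 4 * ‖(-1 : ℂ)‖ := by
  simp only [norm_div, norm_neg, norm_one, Complex.norm_ofNat]; norm_num

theorem backward_coeff_bound : ‖(2 : ℂ)‖ + ‖(-3 / 2 : ℂ)‖ + 2 ≤ 4 * ‖(2 : ℂ)‖ := by
  simp only [norm_div, norm_neg, Complex.norm_ofNat]; norm_num

theorem isClosed_KPlus : IsClosed KPlus := by
  rw [KPlus_eq]; exact isClosed_boundedSolutions forward_coeff_bound

theorem isClosed_KMinus : IsClosed KMinus := by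
  rw [KMinus_eq]
  exact (isClosed_boundedSolutions backward_coeff_bound).preimage continuous_swap

theorem JMinus_eq : JMinus = KMinus := by
  rw [JMinus, isClosed_KMinus.frontier_eq]
  have : interior KMinus = ∅ := by
    rw [KMinus_eq]
    have := (Homeomorph.prodComm ℂ ℂ).preimage_interior (boundedSolutions 2 (-3 / 2) 2)
    rw [interior_boundedSolutions_eq_empty backward_coeff_bound (by simp), preimage_empty] at this
    exact this.symm
  rw [this, sdiff_empty]

theorem bmap_iterate_mem_interior_KPlus_iff {z : ℂ × ℂ} (N : ℕ) :
    (bmap ℂ)^[N] z ∈ interior KPlus ↔ z ∈ interior KPlus := by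
  induction N with
  | zero => rfl
  | succ N ih =>
    rw [Function.iterate_succ_apply', ← ih]
    let T : ℂ × ℂ ≃ₜ ℂ × ℂ := ⟨bmap ℂ, continuous_bmap, continuous_bmap_symm⟩
    have hpre : T ⁻¹' KPlus = KPlus := by
      ext z
      have h : (range fun n : ℕ => (bmap ℂ)^[n] z) =
          insert z (range fun n : ℕ => (bmap ℂ)^[n] (bmap ℂ z)) := by
        ext w
        constructor
        · rintro ⟨_ | n, rfl⟩
          exacts [.inl rfl, .inr ⟨n, rfl⟩]
        · rintro (rfl | ⟨n, rfl⟩)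
          exacts [⟨0, rfl⟩, ⟨n + 1, rfl⟩]
      change _ ↔ Bornology.IsBounded (range fun n : ℕ => (bmap ℂ)^[n] z)
      rw [h, Bornology.isBounded_insert]
      rfl
    have := T.preimage_interior KPlus
    rw [hpre] at this
    exact Set.ext_iff.1 this _

/-! ### Real orbits inside `ℂ²` -/

theorem incl_bmap (q : ℝ × ℝ) : incl (bmap ℝ q) = bmap ℂ (incl q) := by
  simp [incl, bmap_apply]

theorem incl_bmap_symm (q : ℝ × ℝ) : incl ((bmap ℝ).symm q) = (bmap ℂ).symm (incl q) := by
  rw [Equiv.eq_symm_apply, ← incl_bmap, Equiv.apply_symm_apply]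

theorem incl_bmap_iterate (n : ℕ) (q : ℝ × ℝ) :
    incl ((bmap ℝ)^[n] q) = (bmap ℂ)^[n] (incl q) :=
  (Function.Semiconj.iterate_right (f := incl) incl_bmap n) q

theorem incl_bmap_symm_iterate (n : ℕ) (q : ℝ × ℝ) :
    incl ((bmap ℝ).symm^[n] q) = (bmap ℂ).symm^[n] (incl q) :=
  (Function.Semiconj.iterate_right (f := incl) incl_bmap_symm n) q

theorem norm_incl (q : ℝ × ℝ) : ‖incl q‖ = ‖q‖ := by
  simp [incl, Prod.norm_def]

theorem continuous_incl : Continuous incl := by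
  unfold incl; fun_prop

theorem mem_realPart_KPlus {q : ℝ × ℝ} :
    q ∈ realPart KPlus ↔ Bornology.IsBounded (range fun n : ℕ => (bmap ℝ)^[n] q) := by
  simp only [realPart, KPlus, mem_preimage, mem_ofPred_eq, isBounded_iff_forall_norm_le,
    forall_mem_range, ← incl_bmap_iterate, norm_incl]

theorem mem_realPart_KMinus {q : ℝ × ℝ} :
    q ∈ realPart KMinus ↔ Bornology.IsBounded (range fun n : ℕ => (bmap ℝ).symm^[n] q) := by
  simp only [realPart, KMinus, mem_preimage, mem_ofPred_eq, isBounded_iff_forall_norm_le,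
    forall_mem_range, ← incl_bmap_symm_iterate, norm_incl]

theorem isClosed_realPart_KMinus : IsClosed (realPart KMinus) :=
  isClosed_KMinus.preimage continuous_incl

/-! ### Basins lie in the interior of `K⁺`, stable manifolds of saddles on its boundary -/

theorem mem_interior_KPlus_of_tendsto {z : ℂ × ℂ}
    (h : Tendsto (fun n : ℕ => (bmap ℂ)^[n] z) atTop (𝓝 (1 / 2, 1 / 2))) : z ∈ interior KPlus := by
  obtain ⟨N, hN⟩ := (h.eventually (Metric.ball_mem_nhds _ (by norm_num : (0 : ℝ) < 1 / 10))).exists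
  refine (bmap_iterate_mem_interior_KPlus_iff N).1
    (interior_maximal (fun w hw => ?_) Metric.isOpen_ball hN)
  rw [mem_ball_iff_norm] at hw
  exact Metric.isBounded_range_of_tendsto _ (tendsto_bmap_iterate_of_norm_le hw.le)

theorem neg_mem_interior_KPlus {z : ℂ × ℂ} (h : z ∈ interior KPlus) : -z ∈ interior KPlus := by
  have hpre : Neg.neg ⁻¹' KPlus = KPlus := by
    ext z
    simp only [KPlus, mem_preimage, mem_ofPred_eq, isBounded_iff_forall_norm_le,
      forall_mem_range, bmap_iterate_neg, norm_neg]
  have := (Homeomorph.neg (ℂ × ℂ)).preimage_interior KPlus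
  rw [show (Homeomorph.neg (ℂ × ℂ)) ⁻¹' KPlus = KPlus from hpre] at this
  rw [← this] at h
  exact h

theorem incl_fixPlus : incl fixPlus = (1 / 2, 1 / 2) := by simp [incl, fixPlus]

theorem incl_neg (q : ℝ × ℝ) : incl (-q) = -incl q := by simp [incl]

theorem incl_mem_interior_KPlus_of_mem_basin {q : ℝ × ℝ}
    (h : q ∈ basin fixPlus ∪ basin fixMinus) : incl q ∈ interior KPlus := by
  rcases h with h | h
  · refine mem_interior_KPlus_of_tendsto ?_
    rw [← incl_fixPlus]
    exact h
  · have h1 : Tendsto (fun n : ℕ => (bmap ℂ)^[n] (-incl q)) atTop (𝓝 (1 / 2, 1 / 2)) := by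
      rw [← incl_fixPlus, ← neg_fixMinus, incl_neg]
      simpa only [bmap_iterate_neg] using Tendsto.neg h
    simpa using neg_mem_interior_KPlus (mem_interior_KPlus_of_tendsto h1)

theorem cubicSeq_incl (q : ℝ × ℝ) (n : ℕ) :
    cubicSeq (1 / 2) (3 / 4) (-1) (incl q) (n + 1) = (((bmap ℝ)^[n] q).2 : ℂ) := by
  have := congrArg Prod.snd (incl_bmap_iterate n q)
  rw [bmap_iterate_eq_cubicSeq] at this
  exact this.symm

/-- The coefficient 3/4 - 3y² tends to 3/4 along orbits attracted to 0 and to -3 along orbits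
attracted to the cycle. The threshold 7/10 thus serves both, with ε = 1 and ε = -1. -/
theorem incl_notMem_interior_KPlus {q : ℝ × ℝ} {ε : ℝ} (hε : ε * ε = 1)
    (h : ∀ᶠ n in atTop, 7 / 10 ≤ ε * (3 / 4 - 3 * ((bmap ℝ)^[n] q).2 ^ 2)) :
    incl q ∉ interior KPlus := by
  obtain ⟨N, hN⟩ := eventually_atTop.1 h
  rw [← bmap_iterate_mem_interior_KPlus_iff N, ← incl_bmap_iterate, KPlus_eq]
  refine notMem_interior_boundedSolutions forward_coeff_bound hε
    (d := fun n => 3 / 4 - 3 * ((bmap ℝ)^[n] ((bmap ℝ)^[N] q)).2 ^ 2) (fun n => ?_) (fun n => ?_) rfl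
  · rw [cubicSeq_incl]; push_cast; ring
  · rw [← Function.iterate_add_apply]; exact hN _ (Nat.le_add_left _ _)

theorem incl_notMem_interior_of_mem_Ws_zero {q : ℝ × ℝ} (h : q ∈ Ws {0}) :
    incl q ∉ interior KPlus := by
  refine incl_notMem_interior_KPlus (ε := 1) (by norm_num) ?_
  have h1 : Tendsto (fun n : ℕ => 1 * (3 / 4 - 3 * ((bmap ℝ)^[n] q).2 ^ 2)) atTop
      (𝓝 (1 * (3 / 4 - 3 * (0 : ℝ × ℝ).2 ^ 2))) :=
    ((((mem_stableSet_singleton.1 h).snd_nhds.pow 2).const_mul 3).const_sub _).const_mul 1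
  exact h1.eventually (le_mem_nhds (by norm_num))

theorem tendsto_sq_of_mem_stableSet_pair {g : ℝ × ℝ ≃ ℝ × ℝ} {q : ℝ × ℝ}
    (h : q ∈ stableSet g {p, p'}) :
    Tendsto (fun n : ℕ => |(g^[n] q).2|) atTop (𝓝 corner) := by
  have h1 := one_lt_corner
  rw [Metric.tendsto_atTop]
  intro ε hε
  obtain ⟨N, hN⟩ := eventually_atTop.1 (h.eventually (gt_mem_nhds hε))
  refine ⟨N, fun n hn => ?_⟩
  obtain ⟨a, ha, had⟩ := (Metric.infDist_lt_iff ⟨p, mem_insert _ _⟩).1 (hN n hn)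
  have ha2 : |a.2| = corner := by
    rcases ha with rfl | rfl
    · rw [p_eq]; exact abs_of_pos (by linarith)
    · rw [p'_eq, abs_neg]; exact abs_of_pos (by linarith)
  rw [← ha2, Real.dist_eq]
  refine (abs_abs_sub_abs_le_abs_sub _ _).trans_lt ?_
  rw [dist_eq_norm] at had
  exact (norm_snd_le (g^[n] q - a)).trans_lt had

theorem incl_notMem_interior_of_mem_Ws_pair {q : ℝ × ℝ} (h : q ∈ Ws {p, p'}) :
    incl q ∉ interior KPlus := by
  refine incl_notMem_interior_KPlus (ε := -1) (by norm_num) ?_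
  have h1 : Tendsto (fun n : ℕ => -1 * (3 / 4 - 3 * |((bmap ℝ)^[n] q).2| ^ 2)) atTop
      (𝓝 (-1 * (3 / 4 - 3 * corner ^ 2))) :=
    ((((tendsto_sq_of_mem_stableSet_pair h).pow 2).const_mul 3).const_sub _).const_mul (-1)
  simp only [sq_abs] at h1
  exact h1.eventually (le_mem_nhds (by rw [corner_sq]; norm_num))

/-! ### Linearization along the unstable direction of the saddle cycle -/

/-- The expanding eigenvalue of `-D f (p)`. -/
def eigen : ℝ := (3 + √11) / 2

theorem eigen_sq : eigen ^ 2 = 3 * eigen + 1 / 2 := by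
  have := Real.sq_sqrt (by norm_num : (0 : ℝ) ≤ 11)
  rw [eigen]
  linear_combination this / 4

theorem lt_eigen : 63 / 20 < eigen := by
  have : (33 / 10 : ℝ) < √11 := Real.lt_sqrt_of_sq_lt (by norm_num)
  rw [eigen]; linarith

theorem eigen_pos : 0 < eigen := by linarith [lt_eigen]

/-- The nonlinearity of the recurrence for the second coordinate along backward orbits of `-f`,
centered at `p`. -/
def recur {𝕜 : Type*} [Field 𝕜] (κ u w : 𝕜) : 𝕜 := w / 2 + 3 * u + 3 * κ * u ^ 2 + u ^ 3

/-- The deviation from `3` of the slope of a chord of the cubic polynomial in `recur`. -/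
def chord {𝕜 : Type*} [Field 𝕜] (κ u u' : 𝕜) : 𝕜 :=
  3 * κ * (u + u') + (u * u + (u * u' + u' * u'))

theorem recur_sub_recur {𝕜 : Type*} [Field 𝕜] (κ u u' w w' : 𝕜) :
    recur κ u' w' - recur κ u w = (w' - w) / 2 + (3 + chord κ u u') * (u' - u) := by
  rw [recur, recur, chord]; ring

theorem norm_chord_le {𝕜 : Type*} [RCLike 𝕜] {κ u u' : 𝕜} (hc : ‖κ‖ ≤ 9 / 8) (hu : ‖u‖ ≤ 1 / 25)
    (hu' : ‖u'‖ ≤ 1 / 25) : ‖chord κ u u'‖ ≤ 1 / 3 := by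
  have hm : ∀ x y : 𝕜, ‖x‖ ≤ 1 / 25 → ‖y‖ ≤ 1 / 25 → ‖x * y‖ ≤ 1 / 625 := fun x y hx hy => by
    rw [norm_mul]
    exact (mul_le_mul hx hy (norm_nonneg _) (by norm_num)).trans (by norm_num)
  have h1 : ‖3 * κ * (u + u')‖ ≤ 27 / 100 := by
    rw [norm_mul, norm_mul, RCLike.norm_ofNat]
    have := mul_le_mul hc ((norm_add_le u u').trans (add_le_add hu hu')) (norm_nonneg _)
      (by norm_num)
    linarith
  rw [chord]
  linarith [norm_add_le (3 * κ * (u + u')) (u * u + (u * u' + u' * u')),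
    norm_add_le (u * u) (u * u' + u' * u'), norm_add_le (u * u') (u' * u'),
    hm u u hu hu, hm u u' hu hu', hm u' u' hu' hu']

theorem norm_recur_sub_le {𝕜 : Type*} [RCLike 𝕜] {κ u u' : 𝕜} (hc : ‖κ‖ ≤ 9 / 8)
    (hu : ‖u‖ ≤ 1 / 25) (hu' : ‖u'‖ ≤ 1 / 25) (w w' : 𝕜) :
    ‖recur κ u' w' - recur κ u w‖ ≤ 1 / 2 * ‖w' - w‖ + 10 / 3 * ‖u' - u‖ := by
  rw [recur_sub_recur]
  refine (norm_add_le _ _).trans ?_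
  rw [norm_div, norm_mul, RCLike.norm_ofNat]
  have h : ‖3 + chord κ u u'‖ ≤ 10 / 3 := by
    refine (norm_add_le _ _).trans ?_
    rw [RCLike.norm_ofNat]
    linarith [norm_chord_le hc hu hu']
  linarith [mul_le_mul_of_nonneg_right h (norm_nonneg (u' - u))]

theorem norm_corner_le : ‖(corner : ℂ)‖ ≤ 9 / 8 := by
  rw [Complex.norm_real, Real.norm_of_nonneg (by linarith [one_lt_corner])]
  exact corner_lt.le

/-- Successive approximations to the solution of the Poincaré functional equation
`u (λ t) = recur (u t) (u (t / λ))`. -/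
def approx : ℕ → ℂ → ℂ
  | 0, t => t
  | n + 1, t => recur (corner : ℂ) (approx n (t / eigen)) (approx n (t / eigen / eigen))

theorem norm_div_eigen_le (t : ℂ) : ‖t / eigen‖ ≤ 20 / 63 * ‖t‖ := by
  rw [norm_div, Complex.norm_real, Real.norm_of_nonneg eigen_pos.le, div_le_iff₀ eigen_pos]
  nlinarith [lt_eigen, norm_nonneg t]

/-- Since `eigen` is a root of λ² = 3λ + 1/2, the identity solves the functional equation to first
order, and the successive errors are of order |t|². This weight is what makes the step contract: a
Lipschitz constant 10/3 against one factor 20/63 would not suffice, but (10/3)(20/63)² +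
(1/2)(20/63)⁴ < 1/2. The first bound keeps the arguments in the disc of radius 1/25 where the
Lipschitz estimate holds. -/
theorem norm_approx_aux (n : ℕ) {t : ℂ} (ht : ‖t‖ ≤ 1 / 10) :
    ‖approx n t - t‖ ≤ (1 - (1 / 2) ^ n) * ‖t‖ ^ 2 ∧
      ‖approx (n + 1) t - approx n t‖ ≤ (1 / 2) ^ (n + 1) * ‖t‖ ^ 2 := by
  induction n generalizing t with
  | zero =>
    refine ⟨by simp [approx], ?_⟩
    have he : (eigen : ℂ) ≠ 0 := by exact_mod_cast eigen_pos.ne'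
    have hsq : (eigen : ℂ) ^ 2 = 3 * eigen + 1 / 2 := by
      rw [← Complex.ofReal_pow, eigen_sq]
      push_cast
      ring
    have h : approx 1 t - approx 0 t =
        3 * corner * (t / eigen) ^ 2 + (t / eigen) ^ 3 := by
      have : t / eigen / eigen / 2 + 3 * (t / eigen) = t := by
        field_simp
        linear_combination (-2 * t) * hsq
      simp only [approx, recur]
      linear_combination this
    have hd := norm_div_eigen_le t
    have hd2 : ‖t / eigen‖ ^ 2 ≤ (20 / 63) ^ 2 * ‖t‖ ^ 2 := by
      rw [← mul_pow]; exact pow_le_pow_left₀ (norm_nonneg _) hd 2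
    rw [h]
    refine (norm_add_le _ _).trans ?_
    rw [norm_mul, norm_mul, norm_pow, norm_pow, Complex.norm_ofNat]
    have h1 := mul_le_mul_of_nonneg_right norm_corner_le (sq_nonneg ‖t / (eigen : ℂ)‖)
    have h2 : ‖t / (eigen : ℂ)‖ ^ 3 ≤ 1 / 10 * ‖t / (eigen : ℂ)‖ ^ 2 := by
      rw [pow_succ' _ 2]
      exact mul_le_mul_of_nonneg_right (by linarith) (sq_nonneg _)
    nlinarith [sq_nonneg ‖t‖]
  | succ n ih =>
    have hpow : (0 : ℝ) < (1 / 2) ^ (n + 1) := by positivity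
    have key : ∀ s : ℂ, ‖s‖ ≤ 1 / 10 →
        ‖approx (n + 1) s - s‖ ≤ (1 - (1 / 2) ^ (n + 1)) * ‖s‖ ^ 2 := fun s hs => by
      obtain ⟨h1, h2⟩ := ih hs
      have h3 := norm_sub_le_norm_sub_add_norm_sub (approx (n + 1) s) (approx n s) s
      have h4 : ((1 : ℝ) / 2) ^ (n + 1) = (1 / 2) ^ n / 2 := by rw [pow_succ]; ring
      rw [h4] at h2 ⊢
      nlinarith
    refine ⟨key t ht, ?_⟩
    have hd := norm_div_eigen_le t
    have hd' := norm_div_eigen_le (t / eigen)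
    have hs : ‖t / (eigen : ℂ)‖ ≤ 2 / 63 := by linarith
    have hsmall : ∀ w : ℂ, ‖w - t / eigen‖ ≤ ‖t / (eigen : ℂ)‖ ^ 2 → ‖w‖ ≤ 1 / 25 := fun w hw => by
      have := norm_add_le (w - t / eigen) (t / eigen)
      rw [sub_add_cancel] at this
      nlinarith [norm_nonneg (t / (eigen : ℂ))]
    have hpow1 : (0 : ℝ) < (1 / 2) ^ n := by positivity
    have hu := hsmall (approx n (t / eigen)) ((ih (by linarith)).1.trans
      (by nlinarith [sq_nonneg ‖t / (eigen : ℂ)‖]))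
    have hu' := hsmall (approx (n + 1) (t / eigen)) ((key _ (by linarith)).trans
      (by nlinarith [sq_nonneg ‖t / (eigen : ℂ)‖]))
    have hmain := norm_recur_sub_le norm_corner_le hu hu'
      (approx n (t / eigen / eigen)) (approx (n + 1) (t / eigen / eigen))
    have h1 := (ih (t := t / eigen) (by linarith)).2
    have h2 := (ih (t := t / eigen / eigen) (by linarith [norm_nonneg (t / (eigen : ℂ))])).2
    have hd2 : ‖t / eigen‖ ^ 2 ≤ (20 / 63) ^ 2 * ‖t‖ ^ 2 := by
      rw [← mul_pow]; exact pow_le_pow_left₀ (norm_nonneg _) hd 2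
    have hd3 : ‖t / eigen / eigen‖ ^ 2 ≤ (20 / 63) ^ 2 * ‖t / eigen‖ ^ 2 := by
      rw [← mul_pow]; exact pow_le_pow_left₀ (norm_nonneg _) hd' 2
    have h3 := h1.trans (mul_le_mul_of_nonneg_left hd2 hpow.le)
    have h4 := h2.trans (mul_le_mul_of_nonneg_left
      (hd3.trans (mul_le_mul_of_nonneg_left hd2 (by norm_num))) hpow.le)
    have h5 : 0 ≤ (1 / 2 : ℝ) ^ (n + 1) * ‖t‖ ^ 2 := by positivity
    rw [pow_succ _ (n + 1)]
    calc ‖approx (n + 2) t - approx (n + 1) t‖ ≤ _ := hmain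
      _ ≤ _ := by linarith

theorem differentiable_approx (n : ℕ) : Differentiable ℂ (approx n) := by
  induction n with
  | zero => exact differentiable_id
  | succ n ih =>
    have h1 : Differentiable ℂ fun t : ℂ => approx n (t / eigen) :=
      ih.comp (differentiable_id.div_const _)
    have h2 : Differentiable ℂ fun t : ℂ => approx n (t / eigen / eigen) :=
      ih.comp ((differentiable_id.div_const _).div_const _)
    change Differentiable ℂ fun t : ℂ =>
      recur (corner : ℂ) (approx n (t / eigen)) (approx n (t / eigen / eigen))
    simp only [recur]
    fun_prop

theorem approx_im (n : ℕ) (t : ℝ) : (approx n t).im = 0 := by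
  suffices h : ∃ r : ℝ, approx n t = r by
    obtain ⟨r, hr⟩ := h
    rw [hr, Complex.ofReal_im]
  induction n generalizing t with
  | zero => exact ⟨t, rfl⟩
  | succ n ih =>
    obtain ⟨r, hr⟩ := ih (t / eigen)
    obtain ⟨r', hr'⟩ := ih (t / eigen / eigen)
    refine ⟨recur corner r r', ?_⟩
    push_cast at hr hr'
    simp only [approx, recur, hr, hr']
    push_cast
    ring

/-- The limit of the successive approximations. -/
def linearizer (t : ℂ) : ℂ := t + ∑' n, (approx (n + 1) t - approx n t)

theorem norm_approx_succ_sub_le (n : ℕ) {t : ℂ} (ht : ‖t‖ ≤ 1 / 10) :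
    ‖approx (n + 1) t - approx n t‖ ≤ (1 / 2) ^ n := by
  refine (norm_approx_aux n ht).2.trans ?_
  have h : ‖t‖ ^ 2 ≤ 1 := by nlinarith [norm_nonneg t]
  have hpow : (0 : ℝ) < (1 / 2) ^ n := by positivity
  rw [pow_succ]
  nlinarith

theorem tendsto_approx {t : ℂ} (ht : ‖t‖ ≤ 1 / 10) :
    Tendsto (fun n => approx n t) atTop (𝓝 (linearizer t)) := by
  have hs : Summable fun n => approx (n + 1) t - approx n t :=
    Summable.of_norm_bounded summable_geometric_two fun n => norm_approx_succ_sub_le n ht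
  have h := hs.hasSum.tendsto_sum_nat.const_add t
  refine h.congr fun n => ?_
  rw [Finset.sum_range_sub fun n => approx n t]
  simp [approx]

/-- Over ℂ uniform convergence preserves differentiability, so no estimates on derivatives are
needed to obtain a C¹ limit. -/
theorem differentiableOn_linearizer : DifferentiableOn ℂ linearizer (Metric.ball 0 (1 / 10)) := by
  refine differentiableOn_id.add (Complex.differentiableOn_tsum_of_summable_norm summable_geometric_two
    (fun n => ((differentiable_approx (n + 1)).sub (differentiable_approx n)).differentiableOn)
    Metric.isOpen_ball fun n w hw => norm_approx_succ_sub_le n ?_)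
  exact (mem_ball_zero_iff.1 hw).le

theorem norm_linearizer_sub_le {t : ℂ} (ht : ‖t‖ ≤ 1 / 10) :
    ‖linearizer t - t‖ ≤ ‖t‖ ^ 2 := by
  refine le_of_tendsto' ((tendsto_approx ht).sub_const t).norm fun n => ?_
  have hpow : (0 : ℝ) < (1 / 2) ^ n := by positivity
  exact (norm_approx_aux n ht).1.trans (by nlinarith [sq_nonneg ‖t‖])

theorem linearizer_eq {t : ℂ} (ht : ‖t‖ ≤ 1 / 10) :
    linearizer t =
      recur (corner : ℂ) (linearizer (t / eigen)) (linearizer (t / eigen / eigen)) := by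
  have hd := norm_div_eigen_le t
  have hd' := norm_div_eigen_le (t / eigen)
  have h1 := tendsto_approx (t := t / eigen) (by linarith)
  have h2 := tendsto_approx (t := t / eigen / eigen)
    (by linarith [norm_nonneg (t / (eigen : ℂ))])
  refine tendsto_nhds_unique ((tendsto_add_atTop_iff_nat 1).2 (tendsto_approx ht)) ?_
  simp only [approx, recur]
  exact (((h2.div_const 2).add (h1.const_mul 3)).add ((h1.pow 2).const_mul _)).add (h1.pow 3)

/-- A local real solution of the Poincaré functional equation. -/
theorem exists_linearization : ∃ u : ℝ → ℝ,
    (∀ t, |t| < 1 / 10 → ContDiffAt ℝ 1 u t) ∧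
    (∀ t, |t| ≤ 1 / 10 → u t = recur corner (u (t / eigen)) (u (t / eigen / eigen))) ∧
    (∀ t, |t| ≤ 1 / 10 → |u t - t| ≤ t ^ 2) := by
  have hre : ∀ t : ℝ, |t| ≤ 1 / 10 → linearizer t = ((linearizer t).re : ℂ) := fun t ht => by
    have h := (Complex.continuous_im.tendsto _).comp
      (tendsto_approx (t := t) (by rwa [Complex.norm_real]))
    have h0 : (linearizer t).im = 0 := by
      refine tendsto_nhds_unique h ?_
      simp only [Function.comp_def, approx_im]
      exact tendsto_const_nhds
    exact Complex.ext rfl (by simpa using h0)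
  have hdiv : ∀ t : ℝ, |t| ≤ 1 / 10 → |t / eigen| ≤ 1 / 10 := fun t ht => by
    have := norm_div_eigen_le t
    rw [← Complex.ofReal_div, Complex.norm_real, Complex.norm_real, Real.norm_eq_abs,
      Real.norm_eq_abs] at this
    linarith [abs_nonneg t]
  refine ⟨fun t => (linearizer t).re, fun t ht => ?_, fun t ht => ?_, fun t ht => ?_⟩
  · have hmem : Metric.ball (0 : ℂ) (1 / 10) ∈ 𝓝 (t : ℂ) :=
      Metric.isOpen_ball.mem_nhds (by rwa [mem_ball_zero_iff, Complex.norm_real])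
    exact (differentiableOn_linearizer.analyticAt hmem).contDiffAt.real_of_complex
  · have h := linearizer_eq (t := t) (by rwa [Complex.norm_real])
    have h1 := hre _ (hdiv t ht)
    have h2 := hre _ (hdiv _ (hdiv t ht))
    push_cast at h1 h2
    rw [hre t ht, h1, h2] at h
    push_cast
    rw [recur] at h ⊢
    exact_mod_cast h
  · have h := norm_linearizer_sub_le (t := t) (by rwa [Complex.norm_real])
    rw [hre t ht, ← Complex.ofReal_sub, Complex.norm_real, Complex.norm_real, Real.norm_eq_abs,
      Real.norm_eq_abs, sq_abs] at h
    exact h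

/-! ### Extending a local unstable manifold -/

theorem contDiff_iterate {E : Type*} [NormedAddCommGroup E] [NormedSpace ℝ E] {f : E → E}
    (hf : ContDiff ℝ 1 f) (n : ℕ) : ContDiff ℝ 1 f^[n] := by
  induction n with
  | zero => exact contDiff_id
  | succ n ih => rw [Function.iterate_succ]; exact ih.comp hf

/-- The functional equation makes T^n (γ (t / κ^n)) independent of n as long as t / κ^n lies in the
domain, and for each t it does so for large n. Injectivity and immersion are inherited because T is
a diffeomorphism. -/
theorem exists_extension {E : Type*} [NormedAddCommGroup E] [NormedSpace ℝ E] {T : E ≃ E}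
    (hT : ContDiff ℝ 1 T) (hT' : ContDiff ℝ 1 T.symm) {κ ρ : ℝ} (hκ : 1 < κ) (hρ : 0 < ρ)
    {γ : ℝ → E} (hγ : ∀ t, |t| < ρ → ContDiffAt ℝ 1 γ t) (hd : ∀ t, |t| < ρ → deriv γ t ≠ 0)
    (hinj : ∀ s t, |s| < ρ → |t| < ρ → γ s = γ t → s = t)
    (hfe : ∀ t, |t| < ρ → γ t = T (γ (t / κ))) :
    ∃ Γ : ℝ → E, ContDiff ℝ 1 Γ ∧ Function.Injective Γ ∧ (∀ t, deriv Γ t ≠ 0) ∧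
      (∀ t, Γ t = T (Γ (t / κ))) ∧ ∀ t, |t| < ρ → Γ t = γ t := by
  have hκ0 : 0 < κ := by linarith
  have hsmall : ∀ t n, |t| < ρ → |t / κ ^ n| < ρ := fun t n ht => by
    rw [abs_div, abs_of_pos (pow_pos hκ0 n)]
    exact (div_le_self (abs_nonneg t) (one_le_pow₀ hκ.le)).trans_lt ht
  have h0 : ∀ n t, |t| < ρ → T^[n] (γ (t / κ ^ n)) = γ t := by
    intro n
    induction n with
    | zero => simp
    | succ n ih =>
      intro t ht
      rw [Function.iterate_succ_apply, pow_succ, ← div_div, ← hfe _ (hsmall t n ht), ih t ht]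
  have hex : ∀ t : ℝ, ∃ n : ℕ, |t / κ ^ n| < ρ := fun t => by
    obtain ⟨n, hn⟩ := pow_unbounded_of_one_lt (|t| / ρ) hκ
    refine ⟨n, ?_⟩
    rw [abs_div, abs_of_pos (pow_pos hκ0 n), div_lt_iff₀ (pow_pos hκ0 n)]
    rwa [div_lt_iff₀ hρ, mul_comm] at hn
  choose N hN using hex
  set Γ : ℝ → E := fun t => T^[N t] (γ (t / κ ^ N t)) with hΓdef
  have hΓ : ∀ n t, |t / κ ^ n| < ρ → Γ t = T^[n] (γ (t / κ ^ n)) := by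
    intro n t ht
    have h1 := h0 (N t) _ ht
    have h2 := h0 n _ (hN t)
    rw [hΓdef]
    simp only
    rw [← h1, ← h2, ← Function.iterate_add_apply, ← Function.iterate_add_apply, div_div, div_div,
      mul_comm (κ ^ n), add_comm n]
  have hnear : ∀ n t, |t / κ ^ n| < ρ → ∀ᶠ s in 𝓝 t, |s / κ ^ n| < ρ := fun n t ht => by
    have : ContinuousAt (fun s : ℝ => |s / κ ^ n|) t := by fun_prop
    exact this.eventually (gt_mem_nhds ht)
  have hCD : ContDiff ℝ 1 Γ := by
    rw [contDiff_iff_contDiffAt]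
    intro t
    have h1 : ContDiffAt ℝ 1 (fun s : ℝ => T^[N t] (γ (s / κ ^ N t))) t :=
      (contDiff_iterate hT (N t)).contDiffAt.comp t
        (ContDiffAt.comp t (hγ _ (hN t)) (contDiffAt_id.div_const _))
    exact h1.congr_of_eventuallyEq ((hnear _ t (hN t)).mono fun s hs => hΓ _ s hs)
  refine ⟨Γ, hCD, ?_, ?_, ?_, ?_⟩
  · intro s t hst
    set n := max (N s) (N t)
    have hs : |s / κ ^ n| < ρ := by
      obtain ⟨m, hm⟩ := Nat.exists_eq_add_of_le (le_max_left (N s) (N t))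
      rw [show n = N s + m from hm, pow_add, ← div_div]
      exact hsmall _ _ (hN s)
    have ht : |t / κ ^ n| < ρ := by
      obtain ⟨m, hm⟩ := Nat.exists_eq_add_of_le (le_max_right (N s) (N t))
      rw [show n = N t + m from hm, pow_add, ← div_div]
      exact hsmall _ _ (hN t)
    rw [hΓ n s hs, hΓ n t ht] at hst
    have := hinj _ _ hs ht ((T.injective.iterate n) hst)
    exact (div_left_inj' (pow_pos hκ0 n).ne').1 this
  · intro t h
    set n := N t with hn
    have hpos := pow_pos hκ0 n
    have hs := hN t
    rw [← hn] at hs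
    have hmul : κ ^ n * (t / κ ^ n) = t := mul_div_cancel₀ t hpos.ne'
    have h1 : HasDerivAt Γ 0 (κ ^ n * (t / κ ^ n)) := by
      rw [hmul, ← h]
      exact (hCD.differentiable one_ne_zero t).hasDerivAt
    have h2 : HasDerivAt (fun r : ℝ => Γ (κ ^ n * r)) 0 (t / κ ^ n) := by
      have := h1.scomp (t / κ ^ n) ((hasDerivAt_id (t / κ ^ n)).const_mul (κ ^ n))
      simpa [Function.comp_def] using this
    -- Undoing T^n and the rescaling recovers γ, so a zero of the derivative of Γ would give one of
    -- γ.
    have h3 : HasDerivAt (fun r : ℝ => T.symm^[n] (Γ (κ ^ n * r))) 0 (t / κ ^ n) := by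
      have := ((contDiff_iterate hT' n).differentiable one_ne_zero _).hasFDerivAt.comp_hasDerivAt _ h2
      simpa [Function.comp_def] using this
    refine hd _ hs (HasDerivAt.deriv (h3.congr_of_eventuallyEq ?_))
    have hev : ∀ᶠ r in 𝓝 (t / κ ^ n), |r| < ρ := continuous_abs.continuousAt.eventually
      (gt_mem_nhds hs)
    filter_upwards [hev] with r hr
    have h4 : κ ^ n * r / κ ^ n = r := mul_div_cancel_left₀ r hpos.ne'
    rw [hΓ n _ (by rwa [h4]), h4, symm_iterate_iterate]
  · intro t
    have h1 : |t / κ ^ (N t + 1)| < ρ := by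
      rw [pow_add, ← div_div]; exact hsmall _ 1 (hN t)
    rw [hΓ (N t + 1) t h1, hΓ (N t) (t / κ) (by rwa [div_div, ← pow_succ']),
      Function.iterate_succ_apply', div_div, ← pow_succ']
  · intro t ht
    simpa using hΓ 0 t (by simpa using ht)

/-! ### The local unstable manifold of `p` -/

theorem contDiff_bmapSq : ContDiff ℝ 1 bmapSq := by
  change ContDiff ℝ 1 fun q : ℝ × ℝ => (bmap ℝ) ((bmap ℝ) q)
  simp only [bmap_apply]
  fun_prop

theorem contDiff_bmapSq_symm : ContDiff ℝ 1 bmapSq.symm := by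
  change ContDiff ℝ 1 fun q : ℝ × ℝ => (bmap ℝ).symm ((bmap ℝ).symm q)
  simp only [bmap_symm_apply]
  fun_prop

/-- Solutions of the linearized backward recurrence starting with zero vanish or grow. -/
theorem eq_zero_of_bounded {e η : ℕ → ℝ} {C : ℝ} (h0 : e 0 = 0) (hC : ∀ n, |e n| ≤ C)
    (hη : ∀ n, |η n| ≤ 1 / 3) (h : ∀ n, e n = e (n + 2) / 2 + (3 + η n) * e (n + 1)) :
    e 1 = 0 := by
  have key : ∀ n, |e n| ≤ |e (n + 1)| ∧ 3 ^ n * |e 1| ≤ |e (n + 1)| := by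
    intro n
    induction n with
    | zero => simp [h0]
    | succ n ih =>
      have h1 : 8 / 3 * |e (n + 1)| ≤ |(3 + η n) * e (n + 1)| := by
        rw [abs_mul]
        refine mul_le_mul_of_nonneg_right ?_ (abs_nonneg _)
        exact le_abs.2 (.inl (by linarith [(abs_le.1 (hη n)).1]))
      have h2 : (3 + η n) * e (n + 1) = e n - e (n + 2) / 2 := by linarith [h n]
      have h3 := abs_sub (e n) (e (n + 2) / 2)
      rw [h2] at h1
      rw [abs_div, abs_two] at h3
      rw [pow_succ]
      constructor <;> linarith [abs_nonneg (e (n + 1)), ih.1, ih.2]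
  by_contra hne
  have hpos : 0 < |e 1| := abs_pos.2 hne
  obtain ⟨n, hn⟩ := pow_unbounded_of_one_lt (C / |e 1|) (by norm_num : (1 : ℝ) < 3)
  rw [div_lt_iff₀ hpos] at hn
  linarith [(key n).2, hC (n + 1)]

/-- The inverse of `-bmap ℝ`, a map fixing `p`. -/
def negSymm (q : ℝ × ℝ) : ℝ × ℝ := (bmap ℝ).symm (-q)

theorem negSymm_p : negSymm p = p := by rw [negSymm, neg_p, bmap_symm_p']

theorem continuous_negSymm : Continuous negSymm := continuous_bmap_symm.comp continuous_neg

theorem negSymm_iterate_two_mul (n : ℕ) (q : ℝ × ℝ) :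
    negSymm^[2 * n] q = bmapSq.symm^[n] q := by
  rw [Function.iterate_mul]
  congr 1
  ext1 r
  change (bmap ℝ).symm (-(bmap ℝ).symm (-r)) = _
  rw [bmap_symm_neg r, neg_neg]
  rfl

/-- By oddness the square of `negSymm` is the inverse of f², and `negSymm` fixes p. The 2-cycle is
thereby replaced by a fixed point, and the odd iterates converge by continuity. -/
theorem tendsto_negSymm_iterate {q : ℝ × ℝ} (h : q ∈ unstableSet bmapSq {p}) :
    Tendsto (fun n : ℕ => negSymm^[n] q) atTop (𝓝 p) := by
  have h1 : Tendsto (fun n : ℕ => negSymm^[2 * n] q) atTop (𝓝 p) := by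
    simpa only [negSymm_iterate_two_mul] using mem_stableSet_singleton.1 h
  have h2 : Tendsto (fun n : ℕ => negSymm^[2 * n + 1] q) atTop (𝓝 p) := by
    have := (continuous_negSymm.tendsto p).comp h1
    rw [negSymm_p] at this
    simpa only [Function.comp_def, ← Function.iterate_succ_apply'] using this
  rw [tendsto_atTop'] at *
  intro s hs
  obtain ⟨a, ha⟩ := h1 s hs
  obtain ⟨b, hb⟩ := h2 s hs
  refine ⟨2 * (a + b) + 1, fun n hn => ?_⟩
  rcases Nat.even_or_odd' n with ⟨k, rfl | rfl⟩
  · exact ha k (by omega)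
  · exact hb k (by omega)

theorem negSymm_fst (n : ℕ) (q : ℝ × ℝ) :
    (negSymm^[n] q).1 = -(negSymm^[n + 1] q).2 := by
  rw [Function.iterate_succ_apply', negSymm, bmap_symm_apply]
  simp

/-- Second coordinates along the backward orbit satisfy the same recurrence as the values u (t /
λⁿ), so the two sequences can be compared. -/
theorem negSymm_recur (n : ℕ) (q : ℝ × ℝ) :
    (negSymm^[n] q).2 - corner =
      recur corner ((negSymm^[n + 1] q).2 - corner) ((negSymm^[n + 2] q).2 - corner) := by
  have h1 := negSymm_fst (n + 1) q
  have h2 : (negSymm^[n + 1] q).1 =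
      2 * (-(negSymm^[n] q).1) ^ 3 - 3 / 2 * (-(negSymm^[n] q).1) + 2 * (-(negSymm^[n] q).2) := by
    rw [Function.iterate_succ_apply', negSymm, bmap_symm_apply]
    simp
  rw [h1, negSymm_fst n, neg_neg] at h2
  have hc := corner_sq
  simp only [recur]
  linear_combination h2 / 2 + (3 * (negSymm^[n + 1] q).2 - 2 * corner) * hc

/-- The local unstable manifold of `p` defined by a solution of the Poincaré equation. -/
def localCurve (u : ℝ → ℝ) (t : ℝ) : ℝ × ℝ := (-corner - u (t / eigen), corner + u t)

theorem localCurve_eq {u : ℝ → ℝ}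
    (hu : ∀ t, |t| ≤ 1 / 10 → u t = recur corner (u (t / eigen)) (u (t / eigen / eigen)))
    {t : ℝ} (ht : |t| ≤ 1 / 10) : localCurve u t = -bmap ℝ (localCurve u (t / eigen)) := by
  rw [bmap_apply, localCurve, localCurve, hu t ht]
  have hc := corner_sq
  ext
  · simp only [Prod.neg_mk]; ring
  · simp only [Prod.neg_mk, recur]
    linear_combination (-(corner) - 3 * u (t / eigen)) * hc

theorem abs_div_eigen_le (t : ℝ) : |t / eigen| ≤ 1 / 3 * |t| := by
  rw [abs_div, abs_of_pos eigen_pos, div_le_iff₀ eigen_pos]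
  nlinarith [lt_eigen, abs_nonneg t]

theorem localCurve_eq_bmapSq {u : ℝ → ℝ}
    (hu : ∀ t, |t| ≤ 1 / 10 → u t = recur corner (u (t / eigen)) (u (t / eigen / eigen)))
    {t : ℝ} (ht : |t| ≤ 1 / 10) : localCurve u t = bmapSq (localCurve u (t / eigen ^ 2)) := by
  have h1 := abs_div_eigen_le t
  rw [localCurve_eq hu ht, localCurve_eq hu (t := t / eigen) (by linarith [abs_nonneg t]), bmap_neg,
    neg_neg, div_div, ← pow_two]
  rfl

theorem Q₃_eq : Q₃ = Iic (-corner) ×ˢ Ici corner := by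
  ext q
  simp only [Q₃, corner, mem_ofPred_eq, mem_prod, mem_Iic, mem_Ici, neg_div]

theorem interior_Q₃ : interior Q₃ = Iio (-corner) ×ˢ Ioi corner := by
  rw [Q₃_eq, interior_prod_eq, interior_Iic, interior_Ici]

theorem mem_unstableSet_of_scaling {Γ : ℝ → ℝ × ℝ} {κ : ℝ} (hκ : 1 < κ) (hc : Continuous Γ)
    {T : ℝ × ℝ ≃ ℝ × ℝ} (hΓ : ∀ t, Γ t = T (Γ (t / κ))) (t : ℝ) :
    Γ t ∈ unstableSet T {Γ 0} := by
  refine mem_stableSet_singleton.2 ?_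
  have h1 : ∀ n : ℕ, T.symm^[n] (Γ t) = Γ (t / κ ^ n) := by
    intro n
    induction n with
    | zero => simp
    | succ n ih =>
      rw [Function.iterate_succ_apply', ih, Equiv.symm_apply_eq, hΓ, div_div, ← pow_succ]
  simp only [h1]
  have h2 : Tendsto (fun n : ℕ => t / κ ^ n) atTop (𝓝 0) :=
    tendsto_const_nhds.div_atTop (tendsto_pow_atTop_atTop_of_one_lt hκ)
  exact (hc.tendsto 0).comp h2

/-- A point whose backward orbit converges to `p` has a backward iterate on the local curve. -/
theorem exists_iterate_eq_localCurve {u : ℝ → ℝ} {ρ : ℝ} (hρ : 0 < ρ) (hρ' : ρ ≤ 1 / 50)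
    (hcont : ∀ t, |t| < 1 / 10 → ContinuousAt u t)
    (hu : ∀ t, |t| ≤ 1 / 10 → u t = recur corner (u (t / eigen)) (u (t / eigen / eigen)))
    (hut : ∀ t, |t| ≤ 1 / 10 → |u t - t| ≤ t ^ 2) {q : ℝ × ℝ}
    (hq : q ∈ unstableSet bmapSq {p}) :
    ∃ n t, |t| ≤ ρ ∧ bmapSq.symm^[n] q = localCurve u t := by
  have hb : Tendsto (fun n : ℕ => |(negSymm^[n] q).2 - corner|) atTop (𝓝 0) := by
    have := ((tendsto_negSymm_iterate hq).snd_nhds.sub_const corner).abs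
    rwa [p_eq, sub_self, abs_zero] at this
  obtain ⟨N, hN⟩ := eventually_atTop.1 (hb.eventually (gt_mem_nhds (half_pos hρ)))
  have hb' : ∀ n, |(negSymm^[2 * N + n] q).2 - corner| < ρ / 2 := fun n => hN _ (by omega)
  have hb0 := abs_lt.1 (hb' 0)
  have hρt : |ρ| ≤ 1 / 10 := by rw [abs_of_pos hρ]; linarith
  have hu1 := abs_le.1 (hut ρ hρt)
  have hu2 := abs_le.1 (hut (-ρ) (by rwa [abs_neg]))
  have hcontOn : ContinuousOn u (Icc (-ρ) ρ) := fun t ht =>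
    (hcont t (by rw [abs_lt]; constructor <;> linarith [ht.1, ht.2])).continuousWithinAt
  -- The parameter is chosen to match the second coordinate of one backward iterate; |u(±ρ) ∓ ρ| ≤
  -- ρ² leaves room for every value of modulus below ρ/2.
  obtain ⟨t, ht, hut'⟩ := intermediate_value_Icc (by linarith) hcontOn
    (show (negSymm^[2 * N + 0] q).2 - corner ∈ Icc (u (-ρ)) (u ρ) by
      constructor <;> nlinarith)
  have htρ : |t| ≤ ρ := abs_le.2 ht
  refine ⟨N, t, htρ, ?_⟩
  have hpow : ∀ n : ℕ, |t / eigen ^ n| ≤ ρ := fun n => by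
    rw [abs_div, abs_of_pos (pow_pos eigen_pos n)]
    exact (div_le_self (abs_nonneg t) (one_le_pow₀ (by linarith [lt_eigen]))).trans htρ
  have husmall : ∀ n : ℕ, |u (t / eigen ^ n)| ≤ 1 / 25 := fun n => by
    have h1 := hut _ ((hpow n).trans (by linarith))
    have h2 := abs_sub_abs_le_abs_sub (u (t / eigen ^ n)) (t / eigen ^ n)
    rw [← sq_abs] at h1
    nlinarith [abs_nonneg (t / eigen ^ n), hpow n]
  have hrec : ∀ n : ℕ, u (t / eigen ^ n) =
      recur corner (u (t / eigen ^ (n + 1))) (u (t / eigen ^ (n + 2))) := fun n => by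
    rw [hu _ ((hpow n).trans (by linarith)), div_div, div_div, ← pow_succ, ← pow_succ]
  -- Two bounded solutions agreeing at time 0 agree at time 1, because nonzero differences would
  -- grow; two consecutive second coordinates determine the point.
  have he : (negSymm^[2 * N + 1] q).2 - corner - u (t / eigen ^ 1) = 0 := by
    refine eq_zero_of_bounded (e := fun n => (negSymm^[2 * N + n] q).2 - corner - u (t / eigen ^ n))
      (η := fun n => chord corner (u (t / eigen ^ (n + 1)))
        ((negSymm^[2 * N + (n + 1)] q).2 - corner)) (C := 1) ?_ (fun n => ?_) (fun n => ?_)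
      (fun n => ?_)
    · simp only [pow_zero, div_one]; rw [hut', sub_self]
    · refine (abs_sub _ _).trans ?_
      linarith [hb' n, husmall n]
    · refine norm_chord_le (𝕜 := ℝ) ?_ (husmall _) ?_
      · rw [Real.norm_of_nonneg (by linarith [one_lt_corner])]; exact corner_lt.le
      · exact (hb' (n + 1)).le.trans (by linarith)
    · have h1 := recur_sub_recur corner (u (t / eigen ^ (n + 1)))
        ((negSymm^[2 * N + (n + 1)] q).2 - corner) (u (t / eigen ^ (n + 2)))
        ((negSymm^[2 * N + (n + 2)] q).2 - corner)
      rw [← hrec, ← add_assoc, ← add_assoc, ← negSymm_recur] at h1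
      exact h1
  rw [← negSymm_iterate_two_mul, localCurve]
  rw [add_zero] at hut'
  rw [pow_one] at he
  ext
  · rw [negSymm_fst]; simp only; linarith
  · simp only; linarith

theorem exists_isUnstableParam : ∃ Γ, IsUnstableParam Γ p Q₃ := by
  obtain ⟨u, hcd, hu, hut⟩ := exists_linearization
  have hu0 : u 0 = 0 := by simpa using hut 0 (by norm_num)
  have hsm : ContDiffOn ℝ 1 u (Ioo (-(1 / 10)) (1 / 10)) := fun t ht =>
    (hcd t (abs_lt.2 ht)).contDiffWithinAt
  have hder0 : HasDerivAt u 1 0 := by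
    rw [hasDerivAt_iff_isLittleO]
    have h1 : (fun t : ℝ => u t - u 0 - (t - 0) • (1 : ℝ)) =O[𝓝 0] fun t : ℝ => t ^ 2 := by
      refine Asymptotics.IsBigO.of_bound 1 ?_
      filter_upwards [Metric.closedBall_mem_nhds (0 : ℝ) (by norm_num : (0 : ℝ) < 1 / 10)] with t ht
      rw [mem_closedBall_zero_iff, Real.norm_eq_abs] at ht
      simpa [hu0] using hut t ht
    refine h1.trans_isLittleO ?_
    simpa using Asymptotics.isLittleO_pow_id (𝕜 := ℝ) one_lt_two
  have hdcont : ContinuousAt (deriv u) 0 :=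
    (hsm.continuousOn_deriv_of_isOpen isOpen_Ioo le_rfl).continuousAt
      (Ioo_mem_nhds (by norm_num) (by norm_num))
  have hdpos : ∀ᶠ t in 𝓝 (0 : ℝ), 0 < deriv u t :=
    hdcont.eventually (lt_mem_nhds (by rw [hder0.deriv]; norm_num))
  obtain ⟨δ, hδ, hδpos⟩ := Metric.eventually_nhds_iff_ball.1 hdpos
  set ρ := min δ (1 / 50) with hρdef
  have hρ : 0 < ρ := lt_min hδ (by norm_num)
  have hρ50 : ρ ≤ 1 / 50 := min_le_right _ _
  have hdρ : ∀ t, |t| < ρ → 0 < deriv u t := fun t ht =>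
    hδpos t (by rw [mem_ball_zero_iff]; exact ht.trans_le (min_le_left _ _))
  have hcdρ : ∀ t, |t| < ρ → ContDiffAt ℝ 1 (localCurve u) t := fun t ht => by
    have h1 := abs_div_eigen_le t
    exact (contDiffAt_const.sub (ContDiffAt.comp t (hcd (t / eigen) (by linarith [abs_nonneg t]))
      (contDiffAt_id.div_const _))).prodMk (contDiffAt_const.add (hcd t (by linarith)))
  have hsnd : ∀ t, |t| < ρ → (deriv (localCurve u) t).2 = deriv u t := fun t ht => by
    have h1 := ((hcdρ t ht).differentiableAt one_ne_zero).hasDerivAt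
    have h2 := hasFDerivAt_snd.comp_hasDerivAt t h1
    have h3 : HasDerivAt (fun t => corner + u t) (deriv u t) t :=
      ((hcd t (by linarith)).differentiableAt one_ne_zero).hasDerivAt.const_add corner
    exact h2.unique h3
  have hmono : StrictMonoOn u (Ioo (-ρ) ρ) := by
    refine strictMonoOn_of_deriv_pos (convex_Ioo _ _) (fun t ht => ?_) fun t ht => ?_
    · have := abs_lt.2 ht
      exact (hcd t (by linarith)).continuousAt.continuousWithinAt
    · rw [interior_Ioo] at ht
      exact hdρ t (abs_lt.2 ht)
  have hκ : 1 < eigen ^ 2 := by nlinarith [lt_eigen]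
  obtain ⟨Γ, hΓcd, hΓinj, hΓd, hΓfe, hΓloc⟩ := exists_extension contDiff_bmapSq contDiff_bmapSq_symm
    hκ (half_pos hρ) (γ := localCurve u) (fun t ht => hcdρ t (by linarith))
    (fun t ht h => by
      have h1 := hsnd t (by linarith)
      rw [h] at h1
      exact (hdρ t (by linarith)).ne h1)
    (fun s t hs ht h => hmono.injOn (abs_lt.1 (by linarith)) (abs_lt.1 (by linarith))
      (by have := congrArg Prod.snd h; simpa [localCurve] using this))
    (fun t ht => localCurve_eq_bmapSq hu (by linarith))
  have hΓ0 : Γ 0 = p := by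
    rw [hΓloc 0 (by simpa using half_pos hρ), localCurve, zero_div, hu0, p_eq, sub_zero, add_zero]
  have hΓder : HasDerivAt Γ (-(1 / eigen), 1) 0 := by
    have h1 : HasDerivAt (fun t : ℝ => u (t / eigen)) (1 / eigen) 0 := by
      have h := HasDerivAt.comp (h := fun t : ℝ => t / eigen) (0 : ℝ)
        (by rw [zero_div]; exact hder0) ((hasDerivAt_id (0 : ℝ)).div_const eigen)
      simpa [Function.comp_def] using h
    have h2 : HasDerivAt (localCurve u) (-(1 / eigen), 1) 0 :=
      (h1.const_sub (-corner)).prodMk (hder0.const_add corner)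
    refine h2.congr_of_eventuallyEq ?_
    filter_upwards [Metric.ball_mem_nhds (0 : ℝ) (half_pos hρ)] with t ht
    exact hΓloc t (by rwa [mem_ball_zero_iff] at ht)
  refine ⟨Γ, hΓcd, hΓinj, hΓd, ?_, hΓ0, ⟨eigen ^ 2, ?_, ?_⟩, ?_⟩
  · apply Subset.antisymm
    · rintro _ ⟨t, rfl⟩
      rw [← hΓ0]
      exact mem_unstableSet_of_scaling hκ hΓcd.continuous hΓfe t
    · intro q hq
      obtain ⟨n, t, ht, hn⟩ := exists_iterate_eq_localCurve (ρ := ρ / 4) (by linarith)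
        (by linarith) (fun t ht => (hcd t ht).continuousAt) hu hut hq
      rw [← hΓloc t (by linarith)] at hn
      refine ⟨t * (eigen ^ 2) ^ n, ?_⟩
      have hit : ∀ m : ℕ, ∀ s, Γ (s * (eigen ^ 2) ^ m) = bmapSq^[m] (Γ s) := by
        intro m s
        induction m with
        | zero => simp
        | succ m ih =>
          rw [hΓfe, Function.iterate_succ_apply', ← ih, pow_succ, ← mul_assoc,
            mul_div_cancel_right₀ _ (by linarith)]
      rw [hit, ← hn, iterate_symm_iterate]
  · rwa [abs_of_pos (by linarith)]
  · rw [hΓder.deriv]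
    have hne : eigen ^ 2 ≠ 0 := by linarith
    -- Differentiating Γ(λ² t) = f²(Γ(t)) at 0 in both ways gives the eigenvector equation.
    have h1 : HasDerivAt (fun t => Γ (eigen ^ 2 * t)) (eigen ^ 2 • (-(1 / eigen), (1 : ℝ))) 0 := by
      have := HasDerivAt.scomp (h := fun t : ℝ => eigen ^ 2 * t) (0 : ℝ)
        (by rw [mul_zero]; exact hΓder) ((hasDerivAt_id (0 : ℝ)).const_mul (eigen ^ 2))
      rw [mul_one] at this
      exact this
    have h2 : HasDerivAt (fun t => bmapSq (Γ t)) (fderiv ℝ bmapSq p (-(1 / eigen), (1 : ℝ))) 0 := by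
      have h := (contDiff_bmapSq.differentiable one_ne_zero (Γ 0)).hasFDerivAt.comp_hasDerivAt 0 hΓder
      rwa [hΓ0] at h
    have h3 : (fun t => Γ (eigen ^ 2 * t)) = fun t => bmapSq (Γ t) := by
      ext1 t
      rw [hΓfe, mul_div_cancel_left₀ _ hne]
    rw [h3] at h1
    exact h2.unique h1
  · rw [hΓder.deriv, interior_Q₃, p_eq]
    filter_upwards [self_mem_nhdsWithin] with t ht
    have ht : 0 < t := ht
    have := div_pos ht eigen_pos
    constructor
    · simp only [Prod.smul_mk, Prod.mk_add_mk, smul_eq_mul, mem_Iio]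
      have h : t * -(1 / eigen) = -(t / eigen) := by ring
      linarith
    · simp only [Prod.smul_mk, Prod.mk_add_mk, smul_eq_mul, mem_Ioi]
      linarith

/-! ### Symmetry of the parametrizations -/

theorem bmapSq_neg (q : ℝ × ℝ) : bmapSq (-q) = -bmapSq q := by
  change bmap ℝ (bmap ℝ (-q)) = -bmap ℝ (bmap ℝ q)
  rw [bmap_neg, bmap_neg]

theorem bmapSq_symm_iterate (n : ℕ) (q : ℝ × ℝ) :
    bmapSq.symm^[n] q = (bmap ℝ).symm^[2 * n] q := by
  rw [Function.iterate_mul]; rfl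

theorem neg_mem_unstableSet_bmapSq {a q : ℝ × ℝ} (h : q ∈ unstableSet bmapSq {a}) :
    -q ∈ unstableSet bmapSq {-a} := by
  have := (mem_stableSet_singleton.1 h).neg
  refine mem_stableSet_singleton.2 (this.congr fun n => ?_)
  rw [bmapSq_symm_iterate, bmapSq_symm_iterate, bmap_symm_iterate_neg]

theorem IsUnstableParam.neg {Γ : ℝ → ℝ × ℝ} {a : ℝ × ℝ} {Q : Set (ℝ × ℝ)}
    (h : IsUnstableParam Γ a Q) : IsUnstableParam (-Γ) (-a) (Neg.neg ⁻¹' Q) where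
  contDiff := h.contDiff.neg
  injective s t hst := h.injective (neg_injective hst)
  immersion t := by rw [deriv.neg]; exact neg_ne_zero.2 (h.immersion t)
  range_eq := by
    apply Subset.antisymm
    · rintro _ ⟨t, rfl⟩
      exact neg_mem_unstableSet_bmapSq (h.range_eq ▸ mem_range_self t)
    · intro q hq
      have h1 := neg_mem_unstableSet_bmapSq hq
      rw [neg_neg, ← h.range_eq] at h1
      obtain ⟨t, ht⟩ := h1
      exact ⟨t, by rw [Pi.neg_apply, ht, neg_neg]⟩
  map_zero := by rw [Pi.neg_apply, h.map_zero]
  eigenvector := by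
    obtain ⟨μ, hμ, he⟩ := h.eigenvector
    refine ⟨μ, hμ, ?_⟩
    have h1 : fderiv ℝ bmapSq (-a) = fderiv ℝ bmapSq a := by
      have hd := contDiff_bmapSq.differentiable one_ne_zero
      have h2 := ((hd (- -a)).hasFDerivAt.comp (-a) (hasFDerivAt_id (-a)).neg).neg
      have h3 : (-bmapSq ∘ Neg.neg : ℝ × ℝ → ℝ × ℝ) = bmapSq := by
        ext1 q
        simp [bmapSq_neg]
      rw [h3, neg_neg] at h2
      rw [h2.fderiv]
      exact ContinuousLinearMap.ext fun v => by simp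
    rw [deriv.neg, h1, map_neg, he, smul_neg]
  points_into := by
    have h1 := (Homeomorph.neg (ℝ × ℝ)).preimage_interior Q
    change Neg.neg ⁻¹' interior Q = interior (Neg.neg ⁻¹' Q) at h1
    filter_upwards [h.points_into] with t ht
    rw [← h1, deriv.neg, mem_preimage]
    convert ht using 1
    rw [smul_neg, neg_add, neg_neg, neg_neg]

theorem IsUnstableParam.neg_of_p {Γ : ℝ → ℝ × ℝ} (h : IsUnstableParam Γ p Q₃) :
    IsUnstableParam (-Γ) p' Q₃' := by
  have := h.neg
  rwa [neg_p] at this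

theorem IsUnstableParam.neg_of_p' {Γ : ℝ → ℝ × ℝ} (h : IsUnstableParam Γ p' Q₃') :
    IsUnstableParam (-Γ) p Q₃ := by
  have := h.neg
  rw [neg_p'] at this
  convert this using 1
  ext q
  simp [Q₃']

/-! ### The unstable set of the saddle cycle -/

/-- Near a, continuity keeps the next iterate within half the distance from a to b, so an orbit that
is always close to the pair cannot switch from one fixed point to the other. -/
theorem tendsto_of_tendsto_infDist_pair {X : Type*} [PseudoMetricSpace X] {T : X → X}
    (hT : Continuous T) {a b q : X} (ha : T a = a) (hb : T b = b) (hab : 0 < dist a b)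
    (h : Tendsto (fun n : ℕ => Metric.infDist (T^[n] q) {a, b}) atTop (𝓝 0)) :
    Tendsto (fun n : ℕ => T^[n] q) atTop (𝓝 a) ∨ Tendsto (fun n : ℕ => T^[n] q) atTop (𝓝 b) := by
  wlog hN : ∃ᶠ n in atTop, dist (T^[n] q) a ≤ dist (T^[n] q) b generalizing a b
  · refine (this hb ha (by rwa [dist_comm]) (by rwa [pair_comm]) ?_).symm
    exact (not_frequently.1 hN).frequently.mono fun n hn => (not_le.1 hn).le
  left
  obtain ⟨δ, hδ, hδT⟩ := Metric.continuousAt_iff.1 (hT.continuousAt (x := a)) (dist a b / 2)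
    (half_pos hab)
  rw [ha] at hδT
  have hnear : ∀ ε > 0, ∀ᶠ n in atTop, dist (T^[n] q) a < ε ∨ dist (T^[n] q) b < ε := by
    intro ε hε
    filter_upwards [h.eventually (gt_mem_nhds hε)] with n hn
    obtain ⟨c, rfl | rfl, hc⟩ := (Metric.infDist_lt_iff ⟨a, mem_insert _ _⟩).1 hn
    exacts [.inl hc, .inr hc]
  set r := min δ (dist a b / 2) with hr
  have hr0 : 0 < r := lt_min hδ (half_pos hab)
  obtain ⟨M, hM⟩ := eventually_atTop.1 (hnear r hr0)
  obtain ⟨N, hNM, hN⟩ := frequently_atTop.1 hN M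
  have hall : ∀ n ≥ N, dist (T^[n] q) a < r := by
    intro n hn
    induction n, hn using Nat.le_induction with
    | base => exact (hM N hNM).elim id fun h => hN.trans_lt h
    | succ n hn ih =>
      refine (hM (n + 1) (by omega)).elim id fun h1 => ?_
      have h2 := hδT (ih.trans_le (min_le_left _ _))
      rw [Function.iterate_succ_apply'] at h1
      have h3 := dist_triangle_left a b (T (T^[n] q))
      linarith [min_le_right δ (dist a b / 2)]
  rw [Metric.tendsto_atTop]
  intro ε hε
  obtain ⟨M', hM'⟩ := eventually_atTop.1 (hnear (min ε r) (lt_min hε hr0))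
  refine ⟨max N M', fun n hn => ?_⟩
  rcases hM' n (le_of_max_le_right hn) with h1 | h1
  · exact h1.trans_le (min_le_left _ _)
  · have h2 := hall n (le_of_max_le_left hn)
    have h3 := dist_triangle_left a b (T^[n] q)
    linarith [min_le_right δ (dist a b / 2), min_le_right ε r]

theorem bmapSq_symm_p : bmapSq.symm p = p := by
  change (bmap ℝ).symm ((bmap ℝ).symm p) = p
  rw [bmap_symm_p, bmap_symm_p']

theorem bmapSq_symm_p' : bmapSq.symm p' = p' := by
  change (bmap ℝ).symm ((bmap ℝ).symm p') = p'
  rw [bmap_symm_p', bmap_symm_p]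

theorem p_ne_p' : p ≠ p' := by
  have := one_lt_corner
  rw [p_eq, p'_eq]
  intro h
  linarith [congrArg Prod.snd h]

theorem negSymm_iterate_eq (n : ℕ) (q : ℝ × ℝ) :
    (bmap ℝ).symm^[n] q = negSymm^[n] q ∨ (bmap ℝ).symm^[n] q = -negSymm^[n] q := by
  induction n with
  | zero => exact .inl rfl
  | succ n ih =>
    rw [Function.iterate_succ_apply', Function.iterate_succ_apply']
    rcases ih with h | h
    · right; rw [h, negSymm, bmap_symm_neg, neg_neg]
    · left; rw [h, negSymm]

theorem mem_Wu_pair_of_mem_unstableSet {q : ℝ × ℝ} (h : q ∈ unstableSet bmapSq {p}) :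
    q ∈ Wu {p, p'} := by
  have h1 := tendsto_iff_dist_tendsto_zero.1 (tendsto_negSymm_iterate h)
  refine squeeze_zero (fun n => Metric.infDist_nonneg) (fun n => ?_) h1
  rcases negSymm_iterate_eq n q with h2 | h2
  · rw [h2]; exact Metric.infDist_le_dist_of_mem (mem_insert _ _)
  · rw [h2, ← dist_neg_neg, neg_p]
    exact Metric.infDist_le_dist_of_mem (mem_insert_of_mem _ rfl)

theorem neg_mem_Wu_pair {q : ℝ × ℝ} (h : q ∈ Wu {p, p'}) : -q ∈ Wu {p, p'} := by
  refine Tendsto.congr (fun n => ?_) h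
  rw [bmap_symm_iterate_neg]
  have h1 : ({p, p'} : Set (ℝ × ℝ)) = Neg.neg '' {p, p'} := by
    rw [image_pair, neg_p, neg_p', pair_comm]
  conv_rhs => rw [h1]
  exact (Metric.infDist_image (IsometryEquiv.neg (ℝ × ℝ)).isometry).symm

theorem Wu_pair_eq : Wu {p, p'} = unstableSet bmapSq {p} ∪ unstableSet bmapSq {p'} := by
  apply Subset.antisymm
  · intro q hq
    have h1 : Tendsto (fun n : ℕ => Metric.infDist (bmapSq.symm^[n] q) {p, p'}) atTop (𝓝 0) := by
      simp only [bmapSq_symm_iterate]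
      have h2 : Tendsto (fun n : ℕ => Metric.infDist ((bmap ℝ).symm^[n] q) {p, p'}) atTop (𝓝 0) :=
        hq
      exact h2.comp (tendsto_id.const_mul_atTop' (by norm_num : 0 < 2))
    rcases tendsto_of_tendsto_infDist_pair contDiff_bmapSq_symm.continuous bmapSq_symm_p
      bmapSq_symm_p' (dist_pos.2 p_ne_p') h1 with h | h
    · exact .inl (mem_stableSet_singleton.2 h)
    · exact .inr (mem_stableSet_singleton.2 h)
  · rintro q (h | h)
    · exact mem_Wu_pair_of_mem_unstableSet h
    · have h1 := neg_mem_unstableSet_bmapSq h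
      rw [neg_p'] at h1
      simpa using neg_mem_Wu_pair (mem_Wu_pair_of_mem_unstableSet h1)

/-! ### The two halves of the unstable manifold of `p` -/

theorem isClosed_realPart_KPlus : IsClosed (realPart KPlus) :=
  isClosed_KPlus.preimage continuous_incl

theorem mem_realPart_KPlus_of_norm_bmap_bmap_le {q : ℝ × ℝ}
    (h : ‖bmap ℝ (bmap ℝ q)‖ ≤ corner) : q ∈ realPart KPlus := by
  rw [mem_realPart_KPlus]
  have h1 := (isBounded_range_iterate h).union
    ((finite_Iio 2).image fun n : ℕ => (bmap ℝ)^[n] q).isBounded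
  refine h1.subset ?_
  rintro _ ⟨n, rfl⟩
  rcases lt_or_ge n 2 with hn | hn
  · exact .inr (mem_image_of_mem _ hn)
  · obtain ⟨m, rfl⟩ := Nat.exists_eq_add_of_le' hn
    exact .inl ⟨m, (Function.iterate_add_apply (bmap ℝ) m 2 q).symm⟩

theorem Wu_pair_subset_KMinus : Wu {p, p'} ⊆ realPart KMinus := fun _ h =>
  mem_realPart_KMinus.2
    (isBounded_range_of_mem_stableSet ⟨p, mem_insert _ _⟩ (toFinite _).isBounded h)

theorem eventually_lt_of_hasDerivAt_pos {f : ℝ → ℝ} {d : ℝ} (hf : HasDerivAt f d 0) (hd : 0 < d) :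
    (∀ᶠ t in 𝓝[>] 0, f 0 < f t) ∧ ∀ᶠ t in 𝓝[<] 0, f t < f 0 := by
  have h := (hasDerivAt_iff_tendsto_slope.1 hf).eventually (lt_mem_nhds hd)
  constructor
  · filter_upwards [h.filter_mono (nhdsWithin_mono 0 fun t (ht : 0 < t) => ht.ne'),
      self_mem_nhdsWithin] with t ht ht0
    have ht0 : 0 < t := ht0
    rw [slope_def_field, sub_zero] at ht
    rcases div_pos_iff.1 ht with h | h <;> linarith
  · filter_upwards [h.filter_mono (nhdsWithin_mono 0 fun t (ht : t < 0) => ht.ne),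
      self_mem_nhdsWithin] with t ht ht0
    have ht0 : t < 0 := ht0
    rw [slope_def_field, sub_zero] at ht
    rcases div_pos_iff.1 ht with h | h <;> linarith

section Halves

variable {Γ : ℝ → ℝ × ℝ}

theorem IsUnstableParam.deriv_sign (h : IsUnstableParam Γ p Q₃) :
    (deriv Γ 0).1 < 0 ∧ 0 < (deriv Γ 0).2 := by
  obtain ⟨t, ht, ht0⟩ := (h.points_into.and self_mem_nhdsWithin).exists
  have ht0 : 0 < t := ht0
  rw [interior_Q₃, p_eq] at ht
  have h1 : -corner + t * (deriv Γ 0).1 < -corner := ht.1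
  have h2 : corner < corner + t * (deriv Γ 0).2 := ht.2
  constructor <;> nlinarith

theorem IsUnstableParam.mem_KMinus (h : IsUnstableParam Γ p Q₃) (t : ℝ) :
    Γ t ∈ realPart KMinus :=
  Wu_pair_subset_KMinus (mem_Wu_pair_of_mem_unstableSet (h.range_eq ▸ mem_range_self t))

theorem IsUnstableParam.ne_p' (h : IsUnstableParam Γ p Q₃) (t : ℝ) : Γ t ≠ p' := by
  intro ht
  have h1 : Γ t ∈ unstableSet bmapSq {p} := h.range_eq ▸ mem_range_self t
  rw [ht] at h1
  have h2 := mem_stableSet_singleton.1 h1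
  simp only [Function.iterate_fixed bmapSq_symm_p'] at h2
  exact p_ne_p' (tendsto_nhds_unique tendsto_const_nhds h2).symm

theorem IsUnstableParam.ne_p (h : IsUnstableParam Γ p Q₃) {t : ℝ} (ht : t ≠ 0) : Γ t ≠ p :=
  fun h1 => ht (h.injective (h1.trans h.map_zero.symm))

theorem IsUnstableParam.hasDerivAt_coords (h : IsUnstableParam Γ p Q₃) :
    HasDerivAt (fun t => (Γ t).1) (deriv Γ 0).1 0 ∧ HasDerivAt (fun t => (Γ t).2) (deriv Γ 0).2 0 :=
  have hd := (h.contDiff.differentiable one_ne_zero 0).hasDerivAt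
  ⟨(hasFDerivAt_fst (𝕜 := ℝ) (p := Γ 0)).comp_hasDerivAt 0 hd,
    (hasFDerivAt_snd (𝕜 := ℝ) (p := Γ 0)).comp_hasDerivAt 0 hd⟩

/-- Moving backwards from p along a tangent vector that points up and to the left enters the square
of radius `corner`. -/
theorem IsUnstableParam.eventually_norm_le (h : IsUnstableParam Γ p Q₃) :
    ∀ᶠ t in 𝓝[<] 0, ‖Γ t‖ ≤ corner := by
  have hc1 := one_lt_corner
  have h0 : Γ 0 = (-corner, corner) := h.map_zero.trans p_eq
  have hcont : ContinuousAt Γ 0 := h.contDiff.continuous.continuousAt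
  have h1 := (eventually_lt_of_hasDerivAt_pos h.hasDerivAt_coords.1.neg
    (neg_pos.2 h.deriv_sign.1)).2
  have h2 := (eventually_lt_of_hasDerivAt_pos h.hasDerivAt_coords.2 h.deriv_sign.2).2
  have h3 : ∀ᶠ t in 𝓝 (0 : ℝ), (Γ t).1 < corner :=
    hcont.fst.eventually (gt_mem_nhds (by simp only [h0]; linarith))
  have h4 : ∀ᶠ t in 𝓝 (0 : ℝ), -corner < (Γ t).2 :=
    hcont.snd.eventually (lt_mem_nhds (by simp only [h0]; linarith))
  filter_upwards [h1, h2, h3.filter_mono nhdsWithin_le_nhds, h4.filter_mono nhdsWithin_le_nhds]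
    with t ht1 ht2 ht3 ht4
  simp only [Pi.neg_apply, h0] at ht1 ht2
  rw [Prod.norm_def, max_le_iff, Real.norm_eq_abs, Real.norm_eq_abs, abs_le, abs_le]
  refine ⟨⟨?_, ?_⟩, ?_, ?_⟩ <;> linarith

theorem IsUnstableParam.norm_bmap_bmap_lt (h : IsUnstableParam Γ p Q₃) {t : ℝ} (ht : t ≠ 0)
    (hK : Γ t ∈ realPart KPlus) : ‖bmap ℝ (bmap ℝ (Γ t))‖ < corner :=
  norm_bmap_bmap_lt_corner_of_isBounded (mem_realPart_KPlus.1 hK)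
    (mem_realPart_KMinus.1 (h.mem_KMinus t)) (h.ne_p ht) (h.ne_p' t)

theorem IsUnstableParam.isOpen_bounded (h : IsUnstableParam Γ p Q₃) :
    IsOpen {t | ‖bmap ℝ (bmap ℝ (Γ t))‖ < corner} :=
  isOpen_lt (continuous_bmap.comp (continuous_bmap.comp h.contDiff.continuous)).norm
    continuous_const

theorem IsUnstableParam.isOpen_unbounded (h : IsUnstableParam Γ p Q₃) :
    IsOpen {t | Γ t ∉ realPart KPlus} :=
  (isClosed_realPart_KPlus.preimage h.contDiff.continuous).isOpen_compl

theorem disjoint_bounded_unbounded : Disjoint {t | ‖bmap ℝ (bmap ℝ (Γ t))‖ < corner}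
    {t | Γ t ∉ realPart KPlus} :=
  disjoint_left.2 fun _ h1 h2 => h2 (mem_realPart_KPlus_of_norm_bmap_bmap_le (le_of_lt h1))

/-- Each t < 0 satisfies exactly one of two open conditions: f² sends Γ(t) into the open square, or
Γ(t) has unbounded forward orbit. The half-line is connected, and near 0 the first one holds. -/
theorem IsUnstableParam.mem_KPlus_of_neg (h : IsUnstableParam Γ p Q₃) {t : ℝ} (ht : t < 0) :
    Γ t ∈ realPart KPlus := by
  obtain ⟨s, hs, hs0⟩ := (h.eventually_norm_le.and self_mem_nhdsWithin).exists
  have hs0 : s < 0 := hs0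
  have hsub := IsPreconnected.subset_left_of_subset_union h.isOpen_bounded h.isOpen_unbounded
    disjoint_bounded_unbounded (s := Iio 0)
    (fun r (hr : r < 0) => (em (Γ r ∈ realPart KPlus)).imp (h.norm_bmap_bmap_lt hr.ne) id)
    ⟨s, hs0, h.norm_bmap_bmap_lt hs0.ne (mem_realPart_KPlus.2 (isBounded_range_iterate hs))⟩
    isPreconnected_Iio
  exact mem_realPart_KPlus_of_norm_bmap_bmap_le (le_of_lt (hsub ht))

theorem IsUnstableParam.notMem_KPlus_of_pos (h : IsUnstableParam Γ p Q₃) {t : ℝ} (ht : 0 < t) :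
    Γ t ∉ realPart KPlus := by
  obtain ⟨s, hs, hs0⟩ := ((eventually_lt_of_hasDerivAt_pos h.hasDerivAt_coords.2
    h.deriv_sign.2).1.and self_mem_nhdsWithin).exists
  have hs0 : 0 < s := hs0
  rw [h.map_zero, p_eq] at hs
  have hsub := IsPreconnected.subset_right_of_subset_union h.isOpen_bounded h.isOpen_unbounded
    disjoint_bounded_unbounded (s := Ioi 0)
    (fun r (hr : 0 < r) => (em (Γ r ∈ realPart KPlus)).imp (h.norm_bmap_bmap_lt hr.ne') id)
    ⟨s, hs0, fun hK => ?_⟩ isPreconnected_Ioi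
  · exact hsub ht
  -- For small positive parameters the second coordinate exceeds `corner`, whereas points of K have
  -- norm at most `corner`.
  · have h1 := norm_le_corner_of_isBounded (mem_realPart_KPlus.1 hK)
      (mem_realPart_KMinus.1 (h.mem_KMinus s))
    have h2 := (le_abs_self _).trans ((norm_snd_le (Γ s)).trans h1)
    linarith

end Halves

theorem neg_mem_realPart_KPlus {q : ℝ × ℝ} : -q ∈ realPart KPlus ↔ q ∈ realPart KPlus := by
  simp only [mem_realPart_KPlus, isBounded_iff_forall_norm_le, forall_mem_range,
    bmap_iterate_neg, norm_neg]

/-- The points of the unstable set of the saddle cycle with bounded forward orbit. -/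
theorem mem_KPlus_iff_of_mem_Wu_pair {Γ Γ' : ℝ → ℝ × ℝ} (h : IsUnstableParam Γ p Q₃)
    (h' : IsUnstableParam Γ' p' Q₃') {q : ℝ × ℝ} (hq : q ∈ Wu {p, p'}) :
    q ∈ realPart KPlus ↔ q ∈ WuMinus Γ Γ' ∪ {p, p'} := by
  have hn := h'.neg_of_p'
  have hneg : ∀ t, Γ' t ∈ realPart KPlus ↔ (-Γ') t ∈ realPart KPlus := fun t =>
    neg_mem_realPart_KPlus.symm
  have hp : p ∈ realPart KPlus := mem_realPart_KPlus.2 (isBounded_range_iterate norm_p.le)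
  have hp' : p' ∈ realPart KPlus := mem_realPart_KPlus.2 (isBounded_range_iterate norm_p'.le)
  constructor
  · intro hK
    rw [Wu_pair_eq, ← h.range_eq, ← h'.range_eq] at hq
    rcases hq with ⟨t, rfl⟩ | ⟨t, rfl⟩ <;> rcases lt_trichotomy t 0 with ht | rfl | ht
    · exact .inl (.inl ⟨t, ht, rfl⟩)
    · exact .inr (.inl h.map_zero)
    · exact (h.notMem_KPlus_of_pos ht hK).elim
    · exact .inl (.inr ⟨t, ht, rfl⟩)
    · exact .inr (.inr h'.map_zero)
    · exact (hn.notMem_KPlus_of_pos ht ((hneg t).1 hK)).elim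
  · rintro ((⟨t, ht, rfl⟩ | ⟨t, ht, rfl⟩) | rfl | rfl)
    · exact h.mem_KPlus_of_neg ht
    · exact (hneg t).2 (hn.mem_KPlus_of_neg ht)
    · exact hp
    · exact hp'

theorem WuMinus_subset_Wu_pair {Γ Γ' : ℝ → ℝ × ℝ} (h : IsUnstableParam Γ p Q₃)
    (h' : IsUnstableParam Γ' p' Q₃') : WuMinus Γ Γ' ⊆ Wu {p, p'} := by
  rw [Wu_pair_eq, ← h.range_eq, ← h'.range_eq]
  exact union_subset_union (image_subset_range _ _) (image_subset_range _ _)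

theorem pair_subset_Wu_pair : {p, p'} ⊆ Wu {p, p'} := by
  have hp : p ∈ Wu {p, p'} := mem_Wu_pair_of_mem_unstableSet (mem_stableSet_singleton.2
    (by simp only [Function.iterate_fixed bmapSq_symm_p]; exact tendsto_const_nhds))
  rintro q (rfl | rfl)
  · exact hp
  · simpa only [neg_p] using neg_mem_Wu_pair hp

/-! ### The sets `K` and `J` in the real plane -/

theorem Wu_zero_subset_KPlus : Wu {0} ⊆ realPart KPlus := fun _ h =>
  mem_realPart_KPlus.2 (isBounded_iff_forall_norm_le.2
    ⟨1 / 2, by rintro _ ⟨n, rfl⟩; exact norm_iterate_le_half_of_mem_Wu_zero h n⟩)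

theorem Wu_zero_subset_KMinus : Wu {0} ⊆ realPart KMinus := fun _ h =>
  mem_realPart_KMinus.2
    (isBounded_range_of_mem_stableSet (singleton_nonempty 0) (toFinite {0}).isBounded h)

theorem mem_of_mem_KMinus {q : ℝ × ℝ} (h : q ∈ realPart KMinus) :
    q = fixPlus ∨ q = fixMinus ∨ q ∈ Wu {0} ∨ q ∈ Wu {p, p'} :=
  bounded_backward_orbit (mem_realPart_KMinus.1 h)

theorem realPart_KMinus_eq : realPart KMinus = closure (Wu {0}) ∪ Wu {p, p'} := by
  apply Subset.antisymm
  · intro q hq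
    rcases mem_of_mem_KMinus hq with rfl | rfl | h | h
    exacts [.inl fixPlus_mem_closure_Wu_zero, .inl fixMinus_mem_closure_Wu_zero,
      .inl (subset_closure h), .inr h]
  · exact union_subset (closure_minimal Wu_zero_subset_KMinus isClosed_realPart_KMinus)
      Wu_pair_subset_KMinus

theorem mem_basin_of_tendsto {q a : ℝ × ℝ}
    (h : Tendsto (fun n : ℕ => (bmap ℝ)^[n] q) atTop (𝓝 a)) : q ∈ basin a := by
  have := (continuous_incl.tendsto a).comp h
  simp only [Function.comp_def, incl_bmap_iterate] at this
  exact this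

theorem Ws_subset_KPlus : Ws {0} ∪ Ws {p, p'} ⊆ realPart KPlus :=
  union_subset
    (fun _ h => mem_realPart_KPlus.2
      (isBounded_range_of_mem_stableSet (singleton_nonempty 0) (toFinite {0}).isBounded h))
    (fun _ h => mem_realPart_KPlus.2
      (isBounded_range_of_mem_stableSet ⟨p, mem_insert _ _⟩ (toFinite _).isBounded h))

theorem realPart_KPlus_eq :
    realPart KPlus = basin fixPlus ∪ basin fixMinus ∪ Ws {0} ∪ Ws {p, p'} := by
  apply Subset.antisymm
  · intro q hq
    rcases bounded_forward_orbit (mem_realPart_KPlus.1 hq) with h | h | h | h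
    exacts [.inl (.inl (.inl (mem_basin_of_tendsto h))),
      .inl (.inl (.inr (mem_basin_of_tendsto h))), .inl (.inr h), .inr h]
  · rw [union_assoc]
    exact union_subset
      (fun q h => interior_subset (s := KPlus) (incl_mem_interior_KPlus_of_mem_basin h))
      Ws_subset_KPlus

/-- Of the four kinds of points in the real part of K⁺, the basins are interior in ℂ² and the two
stable sets are not. -/
theorem realPart_JPlus_eq : realPart JPlus = Ws {0} ∪ Ws {p, p'} := by
  ext q
  rw [realPart, JPlus, isClosed_KPlus.frontier_eq]
  constructor
  · rintro ⟨h1, h2⟩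
    have h1 : q ∈ realPart KPlus := h1
    rw [realPart_KPlus_eq, union_assoc] at h1
    exact h1.resolve_left fun h => h2 (incl_mem_interior_KPlus_of_mem_basin h)
  · intro h
    exact ⟨Ws_subset_KPlus h, h.elim incl_notMem_interior_of_mem_Ws_zero
      incl_notMem_interior_of_mem_Ws_pair⟩

theorem realPart_K_eq {Γ Γ' : ℝ → ℝ × ℝ} (h : IsUnstableParam Γ p Q₃)
    (h' : IsUnstableParam Γ' p' Q₃') :
    realPart K = closure (Wu {0}) ∪ WuMinus Γ Γ' ∪ {p, p'} := by
  have hK : realPart K = realPart KPlus ∩ realPart KMinus := rfl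
  rw [hK, realPart_KMinus_eq, union_assoc]
  apply Subset.antisymm
  · rintro q ⟨h1, h2 | h2⟩
    · exact .inl h2
    · exact .inr ((mem_KPlus_iff_of_mem_Wu_pair h h' h2).1 h1)
  · rintro q (h1 | h1)
    · exact ⟨closure_minimal Wu_zero_subset_KPlus isClosed_realPart_KPlus h1, .inl h1⟩
    · have h2 := union_subset (WuMinus_subset_Wu_pair h h') pair_subset_Wu_pair h1
      exact ⟨(mem_KPlus_iff_of_mem_Wu_pair h h' h2).2 h1, .inr h2⟩

theorem notMem_Ws_of_fixed {a : ℝ × ℝ} (ha : bmap ℝ a = a) (ha0 : a ≠ 0) (han : ‖a‖ < corner) :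
    a ∉ Ws {0} ∪ Ws {p, p'} := by
  rintro (h | h)
  · exact ha0 (eq_of_isFixedPt_of_mem_Ws ha h)
  · exact notMem_stableSet_pair han (N := 0)
      (fun n _ => by rw [Function.iterate_fixed ha]) h

theorem pair_subset_Ws_pair : {p, p'} ⊆ Ws {p, p'} := by
  intro q hq
  have hmem : ∀ n : ℕ, (bmap ℝ)^[n] q ∈ ({p, p'} : Set (ℝ × ℝ)) := by
    intro n
    induction n with
    | zero => exact hq
    | succ n ih =>
      rw [Function.iterate_succ_apply']
      rcases ih with h | h
      · rw [h, bmap_p]; exact .inr rfl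
      · rw [h, bmap_p']; exact .inl rfl
  change Tendsto _ _ _
  simp only [Metric.infDist_zero_of_mem (hmem _)]
  exact tendsto_const_nhds

theorem norm_fixPlus_lt : ‖fixPlus‖ < corner := by
  rw [fixPlus, Prod.norm_mk, max_self, Real.norm_of_nonneg (by norm_num)]
  linarith [one_lt_corner]

/-- Crossing the possible pasts with the two possible futures leaves 0, the cycle, and orbits coming
from the cycle and tending to 0. The latter have bounded forward orbits, so they lie on the negative
halves. -/
theorem realPart_J_eq {Γ Γ' : ℝ → ℝ × ℝ} (h : IsUnstableParam Γ p Q₃)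
    (h' : IsUnstableParam Γ' p' Q₃') :
    realPart J = {0, p, p'} ∪ (WuMinus Γ Γ' ∩ Ws {0}) := by
  have hJ : realPart J = realPart JPlus ∩ realPart JMinus := rfl
  rw [hJ, JMinus_eq, realPart_JPlus_eq]
  apply Subset.antisymm
  · rintro q ⟨hs, hu⟩
    rcases mem_of_mem_KMinus hu with rfl | rfl | hu | hu
    · exact (notMem_Ws_of_fixed bmap_fixPlus fixPlus_ne_zero norm_fixPlus_lt hs).elim
    · refine (notMem_Ws_of_fixed bmap_fixMinus fixMinus_ne_zero ?_ hs).elim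
      rw [← norm_neg, neg_fixMinus]; exact norm_fixPlus_lt
    · rcases hs with hs | hs
      · exact .inl (.inl (Ws_zero_inter_Wu_zero hs hu))
      · exact (disjoint_left.1 disjoint_Ws_pair_Wu_zero hs hu).elim
    · rcases hs with hs | hs
      · rcases (mem_KPlus_iff_of_mem_Wu_pair h h' hu).1 (Ws_subset_KPlus (.inl hs)) with h1 | h1
        · exact .inr ⟨h1, hs⟩
        · exact .inl (.inr h1)
      · exact .inl (.inr (Ws_pair_inter_Wu_pair hs hu))
  · rintro q ((rfl | hq) | ⟨h1, h2⟩)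
    · exact ⟨.inl (mem_stableSet_singleton.2
        (by simp only [Function.iterate_fixed bmap_zero]; exact tendsto_const_nhds)),
        Wu_zero_subset_KMinus (mem_stableSet_singleton.2
          (by simp only [Function.iterate_fixed ((Equiv.symm_apply_eq _).2 bmap_zero.symm)]
              exact tendsto_const_nhds))⟩
    · exact ⟨.inr (pair_subset_Ws_pair hq), Wu_pair_subset_KMinus (pair_subset_Wu_pair hq)⟩
    · exact ⟨.inl h2, Wu_pair_subset_KMinus (WuMinus_subset_Wu_pair h h' h1)⟩

end

end Bieberbach

theorem theorem4p1 :
    (∃ Γ Γ' : ℝ → ℝ × ℝ,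
      Bieberbach.IsUnstableParam Γ Bieberbach.p Bieberbach.Q₃ ∧
      Bieberbach.IsUnstableParam Γ' Bieberbach.p' Bieberbach.Q₃') ∧
    ∀ Γ Γ' : ℝ → ℝ × ℝ,
      Bieberbach.IsUnstableParam Γ Bieberbach.p Bieberbach.Q₃ →
      Bieberbach.IsUnstableParam Γ' Bieberbach.p' Bieberbach.Q₃' →
      Bieberbach.realPart Bieberbach.K =
          closure (Bieberbach.Wu {0}) ∪ Bieberbach.WuMinus Γ Γ' ∪
            {Bieberbach.p, Bieberbach.p'} ∧
      Bieberbach.realPart Bieberbach.KPlus =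
          Bieberbach.basin Bieberbach.fixPlus ∪ Bieberbach.basin Bieberbach.fixMinus ∪
            Bieberbach.Ws {0} ∪ Bieberbach.Ws {Bieberbach.p, Bieberbach.p'} ∧
      Bieberbach.realPart Bieberbach.KMinus =
          closure (Bieberbach.Wu {0}) ∪ Bieberbach.Wu {Bieberbach.p, Bieberbach.p'} ∧
      Bieberbach.realPart Bieberbach.JPlus =
          Bieberbach.Ws {0} ∪ Bieberbach.Ws {Bieberbach.p, Bieberbach.p'} ∧
      Bieberbach.realPart Bieberbach.JMinus = Bieberbach.realPart Bieberbach.KMinus ∧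
      Bieberbach.realPart Bieberbach.J =
          {0, Bieberbach.p, Bieberbach.p'} ∪
            (Bieberbach.WuMinus Γ Γ' ∩ Bieberbach.Ws {0}) := by
  obtain ⟨Γ, hΓ⟩ := Bieberbach.exists_isUnstableParam
  refine ⟨⟨Γ, -Γ, hΓ, hΓ.neg_of_p⟩, fun Γ Γ' h h' => ⟨Bieberbach.realPart_K_eq h h',
    Bieberbach.realPart_KPlus_eq, Bieberbach.realPart_KMinus_eq, Bieberbach.realPart_JPlus_eq, ?_,
    Bieberbach.realPart_J_eq h h'⟩⟩
  rw [Bieberbach.JMinus_eq]
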